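/- Let $\mathcal F$ be a weakly idempotent complete Frobenius category, i.e. an additive category with a Quillen exact structure that has enough projectives and enough injectives and in which projectives and injectives coincide, such that every split monomorphism has a cokernel. Let $A$ be a nonzero projective-injective object of $\mathcal F$. Give $\mathcal F$ the three classes: cofibrations = admissible monomorphisms, fibrations = admissible epimorphisms, weak equivalences = stable equivalences (morphisms that become invertible in the stable category $\underline{\mathcal F}$, the quotient of $\mathcal F$ by the morphisms factoring through projectives). Give the coslice category $(A\downarrow\mathcal F)$ the three classes of morphisms that lie in the corresponding class of $\mathcal F$. Let $0_!:\mathcal F\to(A\downarrow\mathcal F)$, $C\mapsto\left(A\xrightarrow{\binom10}A\oplus C\right)$, be the left adjoint of the forgetful functor $0^*:(A\downarrow\mathcal F)\to\mathcal F$. Choose for each $X\in\mathcal F$ a conflation $X\xrightarrow{\iota_X} I(X)\xrightarrow{\pi_X}\Sigma X$ with $I(X)$ injective. The category $\underline{\mathcal F}$ carries the suspension functor $\Sigma$, and its distinguished triangles are those isomorphic to $X\xrightarrow{f}Y\to Y\sqcup_X I(X)\xrightarrow{d}\Sigma X$, where $d$ is $0$ on $Y$ and $\pi_X$ on $I(X)$.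 The homotopy category $\mathrm{Ho}(A\downarrow\mathcal F)$ (the localization at the weak equivalences) carries the suspension functor $(A\xrightarrow{u}X)\mapsto(A\xrightarrow{0}\Sigma X)$, where $A\xrightarrow{0}\Sigma X$ is obtained from the cone $A\xrightarrow{u} X\xrightarrow{\iota_X} I(X)$ by collapsing $X$ to the terminal object $A\to 0$ (for $X=A\oplus C$ and $u=\binom10$ it is isomorphic in $\mathrm{Ho}(A\downarrow\mathcal F)$ to $A\xrightarrow{\binom10}A\oplus\Sigma C$). Its distinguished triangles are those isomorphic to the cofibre sequences $U\xrightarrow{f}V\to V\sqcup_U I(U)\xrightarrow{d}\Sigma U$ of the morphisms $f$ of $(A\downarrow\mathcal F)$, where $I(U)$ is the cone of $U$ and $d$ collapses $V$. Then: 1. $\mathcal F$ and $(A\downarrow\mathcal F)$ satisfy the axioms of a closed model structure (asking, instead of all finite limits and colimits, only for an initial and a terminal object, pushouts of cofibrations and pullbacks of fibrations), and $(0_!,0^*):\mathcal F\to(A\downarrow\mathcal F)$ is a Quillen equivalence. 2. The projection $\mathcal F\to\underline{\mathcal F}$ is a localization at the weak equivalences, so that $\mathrm{Ho}(\mathcal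 F)=\underline{\mathcal F}$, and $\underline{\mathcal F}$ and $\mathrm{Ho}(A\downarrow\mathcal F)$, with the suspensions and distinguished triangles above, are triangulated categories. 3. The total derived functors $\mathbb L0_!:\underline{\mathcal F}\to\mathrm{Ho}(A\downarrow\mathcal F)$ and $\mathbb R0^*:\mathrm{Ho}(A\downarrow\mathcal F)\to\underline{\mathcal F}$ exist. The functor $\mathbb L0_!$ is a triangle equivalence with quasi-inverse $\mathbb R0^*$; more precisely, $\mathbb L0_!$ is a triangle functor, and the adjunction $\mathbb L0_!\dashv\mathbb R0^*$ derived from $0_!\dashv0^*$ exists and its unit and counit are isomorphisms. -/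

import Mathlib

open CategoryTheory CategoryTheory.Limits

universe v u

noncomputable section

/-! ### Exact categories and Frobenius categories -/

section Exact

variable {C : Type u} [Category.{v} C] [Preadditive C]

/-- Admissible monomorphisms with respect to a class of short complexes. -/
def inflationsOf (P : ShortComplex C → Prop) : MorphismProperty C :=
  fun _ Y i ↦ ∃ (Z : C) (p : Y ⟶ Z) (w : i ≫ p = 0), P (ShortComplex.mk i p w)

/-- Admissible epimorphisms with respect to a class of short complexes. -/
def deflationsOf (P : ShortComplex C → Prop) : MorphismProperty C :=
  fun Y _ p ↦ ∃ (X : C) (i : X ⟶ Y) (w : i ≫ p = 0), P (ShortComplex.mk i p w)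

variable (C) in
/-- An exact structure in the sense of Quillen on an additive category: an isomorphism-closed
class of kernel-cokernel pairs (the conflations) such that identities are inflations and
deflations, inflations (deflations) compose, and inflations (deflations) admit and are stable under
cobase change (base change) along arbitrary morphisms. -/
structure ExactStructure where
  conflation : ShortComplex C → Prop
  conflation_of_iso : ∀ {S T : ShortComplex C}, (S ≅ T) → conflation S → conflation T
  isKernel : ∀ {S : ShortComplex C}, conflation S →
    Nonempty (IsLimit (KernelFork.ofι S.f S.zero))
  isCokernel : ∀ {S : ShortComplex C}, conflation S →
    Nonempty (IsColimit (CokernelCofork.ofπ S.g S.zero))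
  inflation_id : ∀ X : C, inflationsOf conflation (𝟙 X)
  deflation_id : ∀ X : C, deflationsOf conflation (𝟙 X)
  inflation_comp : ∀ {X Y Z : C} (f : X ⟶ Y) (g : Y ⟶ Z), inflationsOf conflation f →
    inflationsOf conflation g → inflationsOf conflation (f ≫ g)
  deflation_comp : ∀ {X Y Z : C} (f : X ⟶ Y) (g : Y ⟶ Z), deflationsOf conflation f →
    deflationsOf conflation g → deflationsOf conflation (f ≫ g)
  exists_pushout : ∀ {X Y X' : C} (i : X ⟶ Y) (f : X ⟶ X'), inflationsOf conflation i →
    ∃ (Y' : C) (g : Y ⟶ Y') (i' : X' ⟶ Y'), IsPushout i f g i' ∧ inflationsOf conflation i'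
  exists_pullback : ∀ {Y Z Z' : C} (p : Y ⟶ Z) (f : Z' ⟶ Z), deflationsOf conflation p →
    ∃ (Y' : C) (g : Y' ⟶ Y) (p' : Y' ⟶ Z'), IsPullback g p' p f ∧ deflationsOf conflation p'

variable (C) in
/-- Every split monomorphism has a cokernel (equivalently, every split epimorphism has a
kernel). -/
def WeaklyIdempotentComplete : Prop :=
  ∀ ⦃X Y : C⦄ (f : X ⟶ Y), IsSplitMono f → HasCokernel f

namespace ExactStructure

variable (E : ExactStructure C)

def inflations : MorphismProperty C := inflationsOf E.conflation

def deflations : MorphismProperty C := deflationsOf E.conflation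

def IsProjective (P : C) : Prop :=
  ∀ ⦃Y Z : C⦄ (p : Y ⟶ Z), E.deflations p → ∀ f : P ⟶ Z, ∃ g : P ⟶ Y, g ≫ p = f

def IsInjective (I : C) : Prop :=
  ∀ ⦃X Y : C⦄ (i : X ⟶ Y), E.inflations i → ∀ f : X ⟶ I, ∃ g : Y ⟶ I, i ≫ g = f

/-- A Frobenius category: an exact category with enough projectives and enough injectives in which
the projective objects coincide with the injective objects. -/
class IsFrobenius : Prop where
  enough_projectives : ∀ X : C, ∃ (P : C) (p : P ⟶ X), E.IsProjective P ∧ E.deflations p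
  enough_injectives : ∀ X : C, ∃ (I : C) (i : X ⟶ I), E.IsInjective I ∧ E.inflations i
  projective_iff_injective : ∀ X : C, E.IsProjective X ↔ E.IsInjective X

/-! ### The stable category and its suspension -/

/-- Two morphisms are stably equal if their difference factors through a projective object. -/
def stableRel : HomRel C := fun X Y f g ↦
  ∃ (P : C) (a : X ⟶ P) (b : P ⟶ Y), E.IsProjective P ∧ f - g = a ≫ b

/-- The stable category: the quotient by morphisms factoring through projective objects. -/
abbrev Stable : Type u := CategoryTheory.Quotient E.stableRel

/-- The projection functor onto the stable category. -/
abbrev toStable : C ⥤ E.Stable := CategoryTheory.Quotient.functor E.stableRel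

/-- The stable equivalences: morphisms that become invertible in the stable category. -/
def stableEquivalences : MorphismProperty C :=
  (MorphismProperty.isomorphisms E.Stable).inverseImage E.toStable

/-- A conflation `X ⟶ I ⟶ Z` with `I` injective. -/
structure InjectiveCopresentation (X : C) where
  I : C
  Z : C
  ι : X ⟶ I
  π : I ⟶ Z
  w : ι ≫ π = 0
  conflation : E.conflation (ShortComplex.mk ι π w)
  injective : E.IsInjective I

variable [E.IsFrobenius]

lemma nonempty_injectiveCopresentation (X : C) : Nonempty (E.InjectiveCopresentation X) := by
  obtain ⟨I, i, hI, Z, p, w, h⟩ := IsFrobenius.enough_injectives (E := E) X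
  exact ⟨⟨I, Z, i, p, w, h, hI⟩⟩

/-- A chosen conflation `X ⟶ I(X) ⟶ ΣX` with `I(X)` injective. -/
def hull (X : C) : E.InjectiveCopresentation X :=
  Classical.choice (E.nonempty_injectiveCopresentation X)

/-- The object `I(X)`. -/
abbrev inj (X : C) : C := (E.hull X).I

/-- The object `ΣX = I(X)/X`. -/
abbrev susp (X : C) : C := (E.hull X).Z

abbrev ι (X : C) : X ⟶ E.inj X := (E.hull X).ι

abbrev π (X : C) : E.inj X ⟶ E.susp X := (E.hull X).π

lemma ι_π (X : C) : E.ι X ≫ E.π X = 0 := (E.hull X).w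

lemma π_desc {X Y : C} (g : E.inj X ⟶ Y) (hg : E.ι X ≫ g = 0) :
    ∃ h : E.susp X ⟶ Y, E.π X ≫ h = g := by
  obtain ⟨hc⟩ := E.isCokernel (E.hull X).conflation
  obtain ⟨l, hl⟩ := CokernelCofork.IsColimit.desc' hc g hg
  exact ⟨l, hl⟩

lemma π_cancel {X Y : C} {g h : E.susp X ⟶ Y} (H : E.π X ≫ g = E.π X ≫ h) : g = h := by
  obtain ⟨hc⟩ := E.isCokernel (E.hull X).conflation
  exact Cofork.IsColimit.hom_ext hc H

/-- `h : ΣX ⟶ ΣY` is induced by some extension `I(X) ⟶ I(Y)` of `f : X ⟶ Y`. -/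
def IsSuspMap {X Y : C} (f : X ⟶ Y) (h : E.susp X ⟶ E.susp Y) : Prop :=
  ∃ g : E.inj X ⟶ E.inj Y, E.ι X ≫ g = f ≫ E.ι Y ∧ E.π X ≫ h = g ≫ E.π Y

lemma exists_suspMap {X Y : C} (f : X ⟶ Y) : ∃ h, E.IsSuspMap f h := by
  obtain ⟨g, hg⟩ := (E.hull Y).injective (E.ι X) ⟨_, _, _, (E.hull X).conflation⟩ (f ≫ E.ι Y)
  obtain ⟨h, hh⟩ := E.π_desc (g ≫ E.π Y) (by rw [← Category.assoc, hg, Category.assoc, ι_π,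
    comp_zero])
  exact ⟨h, g, hg, hh⟩

variable {E} in
lemma IsSuspMap.stableRel {X Y : C} {f f' : X ⟶ Y} {h h' : E.susp X ⟶ E.susp Y}
    (H : E.IsSuspMap f h) (H' : E.IsSuspMap f' h') (hff' : E.stableRel f f') :
    E.stableRel h h' := by
  obtain ⟨g, hg, hh⟩ := H
  obtain ⟨g', hg', hh'⟩ := H'
  obtain ⟨P, a, b, hP, hab⟩ := hff'
  rw [IsFrobenius.projective_iff_injective] at hP
  obtain ⟨a', ha'⟩ := hP (E.ι X) ⟨_, _, _, (E.hull X).conflation⟩ a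
  obtain ⟨t, ht⟩ := E.π_desc (g - g' - a' ≫ b ≫ E.ι Y) (by
    simp only [Preadditive.comp_sub, hg, hg', ← Category.assoc, ha', ← hab,
      Preadditive.sub_comp, sub_self])
  refine ⟨E.inj Y, t, E.π Y, (IsFrobenius.projective_iff_injective _).2 (E.hull Y).injective,
    E.π_cancel ?_⟩
  rw [← Category.assoc, ht]
  simp only [Preadditive.comp_sub, Preadditive.sub_comp, hh, hh', Category.assoc, ι_π, comp_zero,
    sub_zero]

variable {E} in
lemma IsSuspMap.eq {X Y : C} {f : X ⟶ Y} {h h' : E.susp X ⟶ E.susp Y}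
    (H : E.IsSuspMap f h) (H' : E.IsSuspMap f h') :
    E.toStable.map h = E.toStable.map h' :=
  CategoryTheory.Quotient.sound _ (H.stableRel H' ⟨E.inj X, 0, 0,
    (IsFrobenius.projective_iff_injective _).2 (E.hull X).injective, by simp⟩)

/-- A representative of the suspension of a morphism. -/
def suspMap {X Y : C} (f : X ⟶ Y) : E.susp X ⟶ E.susp Y := (E.exists_suspMap f).choose

lemma suspMap_spec {X Y : C} (f : X ⟶ Y) : E.IsSuspMap f (E.suspMap f) :=
  (E.exists_suspMap f).choose_spec

/-- The suspension as a functor to the stable category. -/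
@[simps]
def toStableSusp : C ⥤ E.Stable where
  obj X := E.toStable.obj (E.susp X)
  map f := E.toStable.map (E.suspMap f)
  map_id X := by
    rw [← E.toStable.map_id]
    exact (E.suspMap_spec _).eq ⟨𝟙 _, by simp, by simp⟩
  map_comp {X Y Z} f g := by
    rw [← E.toStable.map_comp]
    refine (E.suspMap_spec _).eq ?_
    obtain ⟨f', hf, hf'⟩ := E.suspMap_spec f
    obtain ⟨g', hg, hg'⟩ := E.suspMap_spec g
    refine ⟨f' ≫ g', ?_, ?_⟩
    · rw [← Category.assoc, hf, Category.assoc, hg, Category.assoc]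
    · rw [← Category.assoc, hf', Category.assoc, hg', Category.assoc]

/-- The suspension functor `Σ` of the stable category, `X ↦ ΣX = I(X)/X`. -/
def suspension : E.Stable ⥤ E.Stable :=
  CategoryTheory.Quotient.lift _ E.toStableSusp (fun _ _ _ _ h ↦
    CategoryTheory.Quotient.sound _ ((E.suspMap_spec _).stableRel (E.suspMap_spec _) h))

end ExactStructure

end Exact

/-! ### Triangulated structures with prescribed suspension and distinguished triangles -/

section Triangles

variable {D : Type*} [Category* D]

/-- A class of diagrams `X ⟶ Y ⟶ Z ⟶ S X`. -/
abbrev TriangleClass (S : D ⥤ D) :=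
  ∀ ⦃X Y Z : D⦄, (X ⟶ Y) → (Y ⟶ Z) → (Z ⟶ S.obj X) → Prop

/-- The triangles that are isomorphic to a triangle of the given class. -/
def TriangleClass.isoClosure {S : D ⥤ D} (P : TriangleClass S) : TriangleClass S :=
  fun X Y Z f g h ↦ ∃ (X' Y' Z' : D) (f' : X' ⟶ Y') (g' : Y' ⟶ Z') (h' : Z' ⟶ S.obj X')
    (a : X ≅ X') (b : Y ≅ Y') (c : Z ≅ Z'), P f' g' h' ∧
      f ≫ b.hom = a.hom ≫ f' ∧ g ≫ c.hom = b.hom ≫ g' ∧ h ≫ S.map a.hom = c.hom ≫ h'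

/-- A triangulated category structure on `D` (including the octahedral axiom) whose suspension
functor is the given functor `S` and whose distinguished triangles are those of the given
class `Δ`. -/
structure TriangulatedStructure (S : D ⥤ D) (Δ : TriangleClass S) where
  hasZeroObject : HasZeroObject D
  preadditive : Preadditive D
  hasShift : HasShift D ℤ
  additive : ∀ n : ℤ, (shiftFunctor D n).Additive
  pretriangulated : Pretriangulated D
  isTriangulated : IsTriangulated D
  shiftIso : shiftFunctor D (1 : ℤ) ≅ S
  mem_distTriang_iff : ∀ T : Pretriangulated.Triangle D,
    T ∈ Pretriangulated.distinguishedTriangles ↔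
      Δ T.mor₁ T.mor₂ (T.mor₃ ≫ shiftIso.hom.app T.obj₁)

/-- A triangle functor: it commutes with the shifts (up to a natural isomorphism) and sends
distinguished triangles to distinguished triangles. -/
def IsTriangleFunctor {D' : Type*} [Category* D'] {S : D ⥤ D} {S' : D' ⥤ D'}
    {Δ : TriangleClass S} {Δ' : TriangleClass S'} (t : TriangulatedStructure S Δ)
    (t' : TriangulatedStructure S' Δ') (F : D ⥤ D') : Prop :=
  letI := t.hasZeroObject
  letI := t.preadditive
  letI := t.hasShift
  letI := t.additive
  letI := t.pretriangulated
  letI := t'.hasZeroObject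
  letI := t'.preadditive
  letI := t'.hasShift
  letI := t'.additive
  letI := t'.pretriangulated
  ∃ _ : F.CommShift ℤ, F.IsTriangulated

end Triangles

/-! ### Closed model structures and Quillen equivalences -/

section Model

/-- Three classes of morphisms: cofibrations, fibrations, weak equivalences. -/
structure ModelClasses (M : Type*) [Category* M] where
  cof : MorphismProperty M
  fib : MorphismProperty M
  weq : MorphismProperty M

namespace ModelClasses

variable {M N : Type*} [Category* M] [Category* N]

/-- The axioms of a closed model structure. As usual for model structures on exact categories,
instead of all finite limits and colimits one only asks for an initial and a terminal object,
cobase changes of cofibrations and base changes of fibrations. -/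
structure IsClosedModel (m : ModelClasses M) : Prop where
  hasInitial : HasInitial M
  hasTerminal : HasTerminal M
  hasPushout : ∀ {X Y Z : M} (i : X ⟶ Y) (f : X ⟶ Z), m.cof i → HasPushout i f
  hasPullback : ∀ {X Y Z : M} (p : X ⟶ Z) (f : Y ⟶ Z), m.fib p → HasPullback p f
  two_out_of_three : m.weq.HasTwoOutOfThreeProperty
  retract_weq : m.weq.IsStableUnderRetracts
  retract_cof : m.cof.IsStableUnderRetracts
  retract_fib : m.fib.IsStableUnderRetracts
  lift_trivCof : ∀ {A B X Y : M} (i : A ⟶ B) (p : X ⟶ Y), m.cof i → m.weq i → m.fib p →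
    HasLiftingProperty i p
  lift_trivFib : ∀ {A B X Y : M} (i : A ⟶ B) (p : X ⟶ Y), m.cof i → m.fib p → m.weq p →
    HasLiftingProperty i p
  fac_trivCof : (m.cof ⊓ m.weq).HasFactorization m.fib
  fac_trivFib : m.cof.HasFactorization (m.fib ⊓ m.weq)

def IsCofibrant (m : ModelClasses M) (X : M) : Prop :=
  ∃ (I : M) (h : IsInitial I), m.cof (h.to X)

def IsFibrant (m : ModelClasses M) (X : M) : Prop :=
  ∃ (T : M) (h : IsTerminal T), m.fib (h.from X)

/-- A Quillen adjunction: the left adjoint preserves cofibrations and acyclic cofibrations. -/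
structure IsQuillenAdjunction (m : ModelClasses M) (n : ModelClasses N) {F : M ⥤ N} {G : N ⥤ M}
    (_ : F ⊣ G) : Prop where
  map_cof : ∀ {X Y : M} (f : X ⟶ Y), m.cof f → n.cof (F.map f)
  map_trivCof : ∀ {X Y : M} (f : X ⟶ Y), m.cof f → m.weq f → n.cof (F.map f) ∧ n.weq (F.map f)

/-- A Quillen equivalence: a Quillen adjunction such that, for `X` cofibrant and `Y` fibrant, a
morphism `F X ⟶ Y` is a weak equivalence if and only if its adjunct `X ⟶ G Y` is. -/
structure IsQuillenEquivalence (m : ModelClasses M) (n : ModelClasses N) {F : M ⥤ N} {G : N ⥤ M}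
    (adj : F ⊣ G) : Prop extends IsQuillenAdjunction m n adj where
  weq_iff : ∀ (X : M) (Y : N) (f : F.obj X ⟶ Y), m.IsCofibrant X → n.IsFibrant Y →
    (n.weq f ↔ m.weq (adj.homEquiv X Y f))

/-- The classes of morphisms of the coslice category `(A ↓ M)`: they are detected in `M`. -/
def under (m : ModelClasses M) (A : M) : ModelClasses (Under A) where
  cof := m.cof.inverseImage (Under.forget A)
  fib := m.fib.inverseImage (Under.forget A)
  weq := m.weq.inverseImage (Under.forget A)

/-- The homotopy category: the localization at the weak equivalences. -/
abbrev Ho (m : ModelClasses M) := m.weq.Localization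

/-- The localization functor to the homotopy category. -/
abbrev toHo (m : ModelClasses M) : M ⥤ m.Ho := m.weq.Q

end ModelClasses

end Model

/-! ### The setting: a Frobenius category and its coslice category -/

section Coslice

variable {C : Type u} [Category.{v} C] [Preadditive C]

/-- The functor `0_! : C ⥤ (A ↓ C)`, cobase change along `0 ⟶ A`: it sends `X` to the coprojection
`A ⟶ A ⊞ X`. -/
@[simps! obj_right obj_hom map_right]
def zeroShriek [HasBinaryBiproducts C] (A : C) : C ⥤ Under A where
  obj X := Under.mk (biprod.inl : A ⟶ A ⊞ X)
  map f := Under.homMk (biprod.map (𝟙 A) f) (by simp)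
  map_id X := by
    apply (Under.forget A).map_injective
    change biprod.map (𝟙 A) (𝟙 X) = 𝟙 (A ⊞ X)
    apply biprod.hom_ext' <;> simp
  map_comp f g := by
    apply (Under.forget A).map_injective
    change biprod.map (𝟙 A) (f ≫ g) = biprod.map (𝟙 A) f ≫ biprod.map (𝟙 A) g
    apply biprod.hom_ext' <;> simp

/-- The adjunction `0_! ⊣ 0^*`, where `0^*` is the forgetful functor. -/
def zeroShriekAdj [HasBinaryBiproducts C] (A : C) : zeroShriek A ⊣ Under.forget A :=
  Adjunction.mkOfHomEquiv
    { homEquiv := fun X Y ↦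
        { toFun := fun f ↦ biprod.inr ≫ f.right
          invFun := fun g ↦ Under.homMk (biprod.desc Y.hom g) (biprod.inl_desc _ _)
          left_inv := fun f ↦ by
            have hf : biprod.inl ≫ f.right = Y.hom := Under.w f
            apply (Under.forget A).map_injective
            change biprod.desc Y.hom (biprod.inr ≫ f.right) = f.right
            apply biprod.hom_ext' <;> simp [hf]
          right_inv := fun g ↦ biprod.inr_desc _ _ }
      homEquiv_naturality_left_symm := fun {X' X Y} f g ↦ by
        apply (Under.forget A).map_injective
        change biprod.desc Y.hom (f ≫ g) = biprod.map (𝟙 A) f ≫ biprod.desc Y.hom g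
        have h₁ : (biprod.inl : A ⟶ A ⊞ X) ≫ biprod.desc Y.hom g = Y.hom := biprod.inl_desc _ _
        have h₂ : (biprod.inr : X ⟶ A ⊞ X) ≫ biprod.desc Y.hom g = g := biprod.inr_desc _ _
        apply biprod.hom_ext' <;> simp [h₁, h₂]
      homEquiv_naturality_right := fun {X Y Y'} f g ↦ by
        exact (Category.assoc (biprod.inr : X ⟶ A ⊞ X) f.right g.right).symm }

namespace ExactStructure

variable (E : ExactStructure C)

/-- The canonical model structure of a Frobenius category: the cofibrations are the admissible
monomorphisms, the fibrations are the admissible epimorphisms, the weak equivalences are the stable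
equivalences. -/
def model : ModelClasses C where
  cof := E.inflations
  fib := E.deflations
  weq := E.stableEquivalences

section Stable

variable [E.IsFrobenius]

/-- The standard triangles `X ⟶ Y ⟶ Cone(f) ⟶ ΣX` of the stable category, where `Cone(f)` is the
pushout of `X ⟶ I(X)` along `f : X ⟶ Y`. -/
inductive IsStandardTriangle : TriangleClass E.suspension
  | mk {X Y W : C} (f : X ⟶ Y) (g : Y ⟶ W) (j : E.inj X ⟶ W) (d : W ⟶ E.susp X)
      (sq : IsPushout f (E.ι X) g j) (hg : g ≫ d = 0) (hj : j ≫ d = E.π X) :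
      IsStandardTriangle (E.toStable.map f) (E.toStable.map g) (E.toStable.map d)

/-- The distinguished triangles of the stable category. -/
def distTriangles : TriangleClass E.suspension :=
  TriangleClass.isoClosure E.IsStandardTriangle

end Stable

variable (A : C)

/-- The homotopy category of the coslice category `(A ↓ C)`. -/
abbrev HoUnder := (E.model.under A).Ho

abbrev toHoUnder : Under A ⥤ E.HoUnder A := (E.model.under A).toHo

/-- The functor `X ↦ (0 : A ⟶ X)`. -/
@[simps! obj_right obj_hom map_right]
def zeroUnder : C ⥤ Under A where
  obj X := Under.mk (0 : A ⟶ X)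
  map f := Under.homMk f (by simp)

lemma toHoUnder_zeroUnder_map_eq [HasBinaryBiproducts C] {X Y : C} {f g : X ⟶ Y}
    (h : E.stableRel f g) :
    (zeroUnder A ⋙ E.toHoUnder A).map f = (zeroUnder A ⋙ E.toHoUnder A).map g := by
  obtain ⟨P, a, b, hP, hab⟩ := h
  let F := zeroUnder A ⋙ E.toHoUnder A
  have hfst : E.stableEquivalences (biprod.fst : X ⊞ P ⟶ X) := by
    refine ⟨⟨E.toStable.map biprod.inl, ?_, ?_⟩⟩
    · rw [← E.toStable.map_comp, ← E.toStable.map_id]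
      refine CategoryTheory.Quotient.sound _ ⟨P, -biprod.snd, biprod.inr, hP, ?_⟩
      rw [sub_eq_iff_eq_add, ← biprod.total, Preadditive.neg_comp, add_comm, add_neg_cancel_right]
    · rw [← E.toStable.map_comp, biprod.inl_fst, E.toStable.map_id]
  have : IsIso (F.map (biprod.fst : X ⊞ P ⟶ X)) :=
    MorphismProperty.Q_inverts (E.model.under A).weq _ hfst
  have key : F.map (biprod.lift (𝟙 X) (0 : X ⟶ P)) = F.map (biprod.lift (𝟙 X) a) := by
    rw [← cancel_mono (F.map (biprod.fst : X ⊞ P ⟶ X)), ← F.map_comp, ← F.map_comp]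
    simp
  have hf : f = biprod.lift (𝟙 X) a ≫ biprod.desc g b := by
    simp [← hab]
  have hg : g = biprod.lift (𝟙 X) (0 : X ⟶ P) ≫ biprod.desc g b := by
    simp
  change F.map f = F.map g
  conv_lhs => rw [hf]
  conv_rhs => rw [hg]
  rw [F.map_comp, F.map_comp, key]

variable [HasBinaryBiproducts C] [E.IsFrobenius]

/-- The functor `(A ↓ C) ⥤ Ho(A ↓ C)` sending `u : A ⟶ X` to its homotopy theoretic suspension.
A cone of `u` is `A ⟶ X ⟶ I(X)`, i.e. a cofibration from `u` to an object which is weakly equivalent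
to the terminal object `A ⟶ 0`; collapsing `u` in it to the terminal object gives
`0 : A ⟶ I(X)/X = ΣX`. A morphism `f` is sent to the class of the morphism induced by an extension
of `f` to the cones. -/
def underSusp : Under A ⥤ E.HoUnder A :=
  Under.forget A ⋙ E.toStable ⋙ E.suspension ⋙
    CategoryTheory.Quotient.lift _ (zeroUnder A ⋙ E.toHoUnder A) (fun _ _ _ _ h ↦ E.toHoUnder_zeroUnder_map_eq A h)

lemma underSusp_inverts : (E.model.under A).weq.IsInvertedBy (E.underSusp A) := by
  intro X Y f hf
  have : IsIso (E.toStable.map f.right) := hf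
  exact Functor.map_isIso (E.suspension ⋙ CategoryTheory.Quotient.lift _ (zeroUnder A ⋙ E.toHoUnder A)
    (fun _ _ _ _ h ↦ E.toHoUnder_zeroUnder_map_eq A h)) (E.toStable.map f.right)

/-- The suspension functor of `Ho(A ↓ C)`. -/
def hoSuspension : E.HoUnder A ⥤ E.HoUnder A :=
  Localization.lift (E.underSusp A) (E.underSusp_inverts A) (E.toHoUnder A)

/-- On `u : A ⟶ X` the suspension functor of `Ho(A ↓ C)` is the suspension of `u`. -/
def hoSuspensionIso :
    E.toHoUnder A ⋙ E.hoSuspension A ≅ E.underSusp A :=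
  Localization.fac (E.underSusp A) (E.underSusp_inverts A) (E.toHoUnder A)

/-- The cone `A ⟶ X ⟶ I(X)` of an object `A ⟶ X` of the coslice category. -/
abbrev coneUnder (U : Under A) : Under A := Under.mk (U.hom ≫ E.ι U.right)

/-- The inclusion into the cone. -/
abbrev ιUnder (U : Under A) : U ⟶ E.coneUnder A U := Under.homMk (E.ι U.right) rfl

/-- The projection from the cone to the suspension. -/
abbrev πUnder (U : Under A) : E.coneUnder A U ⟶ (zeroUnder A).obj (E.susp U.right) :=
  Under.homMk (E.π U.right) (by
    change (U.hom ≫ E.ι U.right) ≫ E.π U.right = 0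
    rw [Category.assoc, ι_π, comp_zero])

/-- The standard triangles of `Ho(A ↓ C)`: the cofibre sequences `U ⟶ V ⟶ Cone(f) ⟶ ΣU` of the
morphisms `f` in `(A ↓ C)`, where `Cone(f)` is the pushout in `(A ↓ C)` of the inclusion of `U`
into its cone along `f : U ⟶ V`, and the last morphism collapses `V` to the terminal object (so
that it is zero on `V` in the underlying category). -/
inductive IsStandardHoTriangle : TriangleClass (E.hoSuspension A)
  | mk {U V W : Under A} (f : U ⟶ V) (g : V ⟶ W) (j : E.coneUnder A U ⟶ W)
      (d : W ⟶ (zeroUnder A).obj (E.susp U.right))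
      (sq : IsPushout f (E.ιUnder A U) g j) (hg : (g ≫ d).right = 0) (hj : j ≫ d = E.πUnder A U) :
      IsStandardHoTriangle ((E.toHoUnder A).map f) ((E.toHoUnder A).map g)
        ((E.toHoUnder A).map d ≫ (E.hoSuspensionIso A).inv.app U)

/-- The distinguished triangles of `Ho(A ↓ C)`. -/
def hoDistTriangles : TriangleClass (E.hoSuspension A) :=
  TriangleClass.isoClosure (E.IsStandardHoTriangle A)

end ExactStructure

end Coslice

end

noncomputable section

/-! Since `A` is projective, it is a zero object of the stable category, and `biprod.inr : X ⟶ A ⊞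
X` is a stable equivalence for every `X`. Hence a morphism out of `0_! X` is a weak equivalence
exactly when its adjunct is, the unit and counit of `0_! ⊣ 0^*` are weak equivalences, and both
functors preserve weak equivalences. The derived functors are therefore the induced functors on
localizations, and the derived adjunction is an adjoint equivalence (`Adjunction.exists_derived`).

For the model structure, acyclic cofibrations are split inclusions with projective complement and
acyclic fibrations are split projections with injective kernel (`exists_retraction_of_trivCof`,
`exists_section_of_trivFib`); this gives the lifting axioms. The retract axioms rest on weak
idempotent completeness through `inflation_of_comp` and `deflation_of_comp`.

On the stable category, `Σ` is an autoequivalence because projectives and injectives coincide, and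
the triangle axioms are checked on mapping cones (`Cone.exists_map`, `Cone.isoClosure_rotate`,
`Cone.exists_octahedron`). A shift by all integers is manufactured from `Σ` by means of spectra
(`exists_hasShift_of_isEquivalence`), and backward rotation follows formally from the other axioms
(`IsForwardPretriangulated.of_rotate`).

The forgetful functor induces an equivalence `hoForget` from `Ho(A ↓ C)` to the stable category that
commutes with the suspensions and detects distinguished triangles (`hoDistTriangles_iff`). The
triangulation of `Ho(A ↓ C)` is pulled back along it, so every quasi-inverse of it is a triangle
functor, in particular the derived functor of `0_!`. -/

lemma CategoryTheory.IsPushout.of_desc_of_hom_ext {C : Type*} [Category* C] {Z X Y P : C}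
    {f : Z ⟶ X} {g : Z ⟶ Y} {inl : X ⟶ P} {inr : Y ⟶ P} (w : f ≫ inl = g ≫ inr)
    (desc : ∀ {T : C} (a : X ⟶ T) (b : Y ⟶ T), f ≫ a = g ≫ b →
      ∃ l : P ⟶ T, inl ≫ l = a ∧ inr ≫ l = b)
    (ext : ∀ {T : C} (l l' : P ⟶ T), inl ≫ l = inl ≫ l' → inr ≫ l = inr ≫ l' → l = l') :
    IsPushout f g inl inr where
  w := w
  isColimit' := ⟨PushoutCocone.IsColimit.mk w
    (fun s ↦ (desc s.inl s.inr s.condition).choose)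
    (fun s ↦ (desc s.inl s.inr s.condition).choose_spec.1)
    (fun s ↦ (desc s.inl s.inr s.condition).choose_spec.2)
    (fun s _ h₁ h₂ ↦ ext _ _
      (h₁.trans (desc s.inl s.inr s.condition).choose_spec.1.symm)
      (h₂.trans (desc s.inl s.inr s.condition).choose_spec.2.symm))⟩

lemma CategoryTheory.IsPullback.of_lift_of_hom_ext {C : Type*} [Category* C] {P X Y Z : C}
    {fst : P ⟶ X} {snd : P ⟶ Y} {f : X ⟶ Z} {g : Y ⟶ Z} (w : fst ≫ f = snd ≫ g)
    (lift : ∀ {T : C} (a : T ⟶ X) (b : T ⟶ Y), a ≫ f = b ≫ g →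
      ∃ l : T ⟶ P, l ≫ fst = a ∧ l ≫ snd = b)
    (ext : ∀ {T : C} (l l' : T ⟶ P), l ≫ fst = l' ≫ fst → l ≫ snd = l' ≫ snd → l = l') :
    IsPullback fst snd f g where
  w := w
  isLimit' := ⟨PullbackCone.IsLimit.mk w
    (fun s ↦ (lift s.fst s.snd s.condition).choose)
    (fun s ↦ (lift s.fst s.snd s.condition).choose_spec.1)
    (fun s ↦ (lift s.fst s.snd s.condition).choose_spec.2)
    (fun s _ h₁ h₂ ↦ ext _ _
      (h₁.trans (lift s.fst s.snd s.condition).choose_spec.1.symm)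
      (h₂.trans (lift s.fst s.snd s.condition).choose_spec.2.symm))⟩

/-! ### Elementary consequences of the axioms of an exact structure -/

namespace ExactStructure

section Basic

variable {C : Type u} [Category.{v} C] [Preadditive C] (E : ExactStructure C)

section Conflation

variable {E} {X Y Z : C} {i : X ⟶ Y} {p : Y ⟶ Z} {w : i ≫ p = 0}

lemma conflation_desc (h : E.conflation (ShortComplex.mk i p w)) {T : C} (g : Y ⟶ T)
    (hg : i ≫ g = 0) : ∃ l : Z ⟶ T, p ≫ l = g := by
  obtain ⟨hc⟩ := E.isCokernel h
  obtain ⟨l, hl⟩ := CokernelCofork.IsColimit.desc' hc g hg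
  exact ⟨l, hl⟩

lemma conflation_lift (h : E.conflation (ShortComplex.mk i p w)) {T : C} (g : T ⟶ Y)
    (hg : g ≫ p = 0) : ∃ l : T ⟶ X, l ≫ i = g := by
  obtain ⟨hc⟩ := E.isKernel h
  obtain ⟨l, hl⟩ := KernelFork.IsLimit.lift' hc g hg
  exact ⟨l, hl⟩

lemma conflation_mono (h : E.conflation (ShortComplex.mk i p w)) : Mono i := by
  obtain ⟨hc⟩ := E.isKernel h
  exact ⟨fun a b hab ↦ Fork.IsLimit.hom_ext hc hab⟩

lemma conflation_epi (h : E.conflation (ShortComplex.mk i p w)) : Epi p := by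
  obtain ⟨hc⟩ := E.isCokernel h
  exact ⟨fun a b hab ↦ Cofork.IsColimit.hom_ext hc hab⟩

lemma conflation_of_iso_left (h : E.conflation (ShortComplex.mk i p w)) {X' : C} (e : X' ≅ X)
    {i' : X' ⟶ Y} (hi' : e.hom ≫ i = i') (w' : i' ≫ p = 0) :
    E.conflation (ShortComplex.mk i' p w') :=
  E.conflation_of_iso (S := .mk i p w) (T := .mk i' p w') (ShortComplex.isoMk e.symm (Iso.refl _) (Iso.refl _)
    (by simp [← hi']) (by simp)) h

lemma conflation_of_iso_right (h : E.conflation (ShortComplex.mk i p w)) {Z' : C} (e : Z ≅ Z')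
    {p' : Y ⟶ Z'} (hp' : p ≫ e.hom = p') (w' : i ≫ p' = 0) :
    E.conflation (ShortComplex.mk i p' w') :=
  E.conflation_of_iso (S := .mk i p w) (T := .mk i p' w') (ShortComplex.isoMk (Iso.refl _)
    (Iso.refl _) e (by simp) (by simp [← hp'])) h

end Conflation

variable {E}

lemma inflation_mono {X Y : C} {i : X ⟶ Y} (hi : E.inflations i) : Mono i := by
  obtain ⟨_, _, _, h⟩ := hi
  exact conflation_mono h

lemma inflation_of_iso {X Y : C} (e : X ≅ Y) : E.inflations e.hom := by
  obtain ⟨Z, p, w, h⟩ := E.inflation_id X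
  have hp : p = 0 := by simpa using w
  refine ⟨Z, e.inv ≫ p, by simp [hp], E.conflation_of_iso ?_ h⟩
  exact ShortComplex.isoMk (Iso.refl _) e (Iso.refl _) (by simp) (by simp)

lemma deflation_of_iso {X Y : C} (e : X ≅ Y) : E.deflations e.hom := by
  obtain ⟨Z, i, w, h⟩ := E.deflation_id X
  have hi : i = 0 := by simpa using w
  refine ⟨Z, i, by simp [hi], E.conflation_of_iso ?_ h⟩
  exact ShortComplex.isoMk (Iso.refl _) (Iso.refl _) e (by simp) (by simp)

lemma inflation_comp' {X Y Z : C} {f : X ⟶ Y} {g : Y ⟶ Z} (hf : E.inflations f)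
    (hg : E.inflations g) : E.inflations (f ≫ g) := E.inflation_comp f g hf hg

lemma deflation_comp' {X Y Z : C} {f : X ⟶ Y} {g : Y ⟶ Z} (hf : E.deflations f)
    (hg : E.deflations g) : E.deflations (f ≫ g) := E.deflation_comp f g hf hg

/-- The axiom only provides some pushout; any other one differs from it by an isomorphism, which is
an inflation. -/
lemma inflation_of_isPushout {X Y X' Y' : C} {i : X ⟶ Y} {f : X ⟶ X'} {g : Y ⟶ Y'}
    {i' : X' ⟶ Y'} (sq : IsPushout i f g i') (hi : E.inflations i) : E.inflations i' := by
  obtain ⟨Y'', g', i'', sq', h⟩ := E.exists_pushout i f hi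
  convert inflation_comp' (E := E) h (inflation_of_iso (sq'.isoIsPushout _ _ sq))
  simp

lemma deflation_of_isPullback {Y Z Y' Z' : C} {p : Y ⟶ Z} {f : Z' ⟶ Z} {g : Y' ⟶ Y}
    {p' : Y' ⟶ Z'} (sq : IsPullback g p' p f) (hp : E.deflations p) : E.deflations p' := by
  obtain ⟨Y'', g', p'', sq', h⟩ := E.exists_pullback p f hp
  convert deflation_comp' (deflation_of_iso (E := E) (sq.isoIsPullback _ _ sq')) h
  simp

/-- A kernel of a deflation forms a conflation with it. -/
lemma conflation_of_deflation {X Y Z : C} {i : X ⟶ Y} {p : Y ⟶ Z} (w : i ≫ p = 0)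
    (hp : E.deflations p) [Mono i]
    (hlift : ∀ {T : C} (k : T ⟶ Y), k ≫ p = 0 → ∃ l : T ⟶ X, l ≫ i = k) :
    E.conflation (ShortComplex.mk i p w) := by
  obtain ⟨K, k, w', h⟩ := hp
  have := conflation_mono h
  obtain ⟨a, ha⟩ := hlift k w'
  obtain ⟨b, hb⟩ := conflation_lift h i w
  refine conflation_of_iso_left h ⟨b, a, ?_, ?_⟩ hb w
  · rw [← cancel_mono i, Category.assoc, ha, hb, Category.id_comp]
  · rw [← cancel_mono k, Category.assoc, hb, ha, Category.id_comp]

/-- A cokernel of an inflation forms a conflation with it. -/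
lemma conflation_of_inflation {X Y Z : C} {i : X ⟶ Y} {p : Y ⟶ Z} (w : i ≫ p = 0)
    (hi : E.inflations i) [Epi p]
    (hdesc : ∀ {T : C} (k : Y ⟶ T), i ≫ k = 0 → ∃ l : Z ⟶ T, p ≫ l = k) :
    E.conflation (ShortComplex.mk i p w) := by
  obtain ⟨K, k, w', h⟩ := hi
  have := conflation_epi h
  obtain ⟨a, ha⟩ := hdesc k w'
  obtain ⟨b, hb⟩ := conflation_desc h p w
  refine conflation_of_iso_right h ⟨b, a, ?_, ?_⟩ hb w
  · rw [← cancel_epi k, ← Category.assoc, hb, ha, Category.comp_id]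
  · rw [← cancel_epi p, ← Category.assoc, ha, hb, Category.comp_id]

/-! ### Biproducts -/

variable [HasBinaryBiproducts C]

variable (E) in
-- The kernel `K` of an identity is a zero object, and the coprojection is a cobase change of `K ⟶
-- Y`.
lemma inflation_inl (X Y : C) : E.inflations (biprod.inl : X ⟶ X ⊞ Y) := by
  obtain ⟨K, i, w, h⟩ := E.deflation_id Y
  have hi : i = 0 := by simpa using w
  have := conflation_mono h
  have hK : 𝟙 K = 0 := by rw [← cancel_mono i, zero_comp, Category.id_comp, hi]
  refine inflation_of_isPushout (i := i) (f := (0 : K ⟶ X)) (g := biprod.inr) ?_ ⟨_, _, w, h⟩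
  refine IsPushout.of_desc_of_hom_ext (by simp [hi]) (fun a b _ ↦ ⟨biprod.desc b a, by simp⟩) ?_
  intro T l l' h₁ h₂
  exact biprod.hom_ext' _ _ h₂ h₁

variable (E) in
lemma conflation_inl_snd (X Y : C) : E.conflation
    (ShortComplex.mk (biprod.inl : X ⟶ X ⊞ Y) (biprod.snd : X ⊞ Y ⟶ Y) (by simp)) :=
  conflation_of_inflation _ (E.inflation_inl X Y) fun k hk ↦
    ⟨biprod.inr ≫ k, by apply biprod.hom_ext' <;> simp [hk]⟩

variable (E) in
lemma deflation_snd (X Y : C) : E.deflations (biprod.snd : X ⊞ Y ⟶ Y) :=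
  ⟨_, _, _, E.conflation_inl_snd X Y⟩

lemma inflation_biprod_map_id (W : C) {X Y : C} {k : X ⟶ Y} (hk : E.inflations k) :
    E.inflations (biprod.map (𝟙 W) k) := by
  refine inflation_of_isPushout (i := k) (f := biprod.inr) (g := biprod.inr) ?_ hk
  refine IsPushout.of_desc_of_hom_ext (by simp)
    (fun a b hab ↦ ⟨biprod.desc (biprod.inl ≫ b) a, by simp, ?_⟩) ?_
  · apply biprod.hom_ext' <;> simp [hab]
  · intro T l l' h₁ h₂
    refine biprod.hom_ext' _ _ ?_ h₁
    simpa using biprod.inl ≫= h₂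

lemma deflation_biprod_map_id (W : C) {X Y : C} {k : X ⟶ Y} (hk : E.deflations k) :
    E.deflations (biprod.map (𝟙 W) k) := by
  refine deflation_of_isPullback (p := k) (f := biprod.snd) (g := biprod.snd) ?_ hk
  refine IsPullback.of_lift_of_hom_ext (by simp)
    (fun a b hab ↦ ⟨biprod.lift (b ≫ biprod.fst) a, by simp, ?_⟩) ?_
  · apply biprod.hom_ext <;> simp [hab]
  · intro T l l' h₁ h₂
    refine biprod.hom_ext _ _ ?_ h₁
    simpa using h₂ =≫ biprod.fst

/-- The automorphism `(x, y) ↦ (x, y + f x)` of `X ⊞ Y`. -/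
@[simps]
def biprodShear {X Y : C} (f : X ⟶ Y) : X ⊞ Y ≅ X ⊞ Y where
  hom := biprod.desc (biprod.lift (𝟙 X) f) biprod.inr
  inv := biprod.desc (biprod.lift (𝟙 X) (-f)) biprod.inr
  hom_inv_id := by
    apply biprod.hom_ext' <;> apply biprod.hom_ext <;> simp [biprod.lift_desc]
  inv_hom_id := by
    apply biprod.hom_ext' <;> apply biprod.hom_ext <;> simp [biprod.lift_desc]

/-- The map is the coprojection `X ⟶ X ⊞ Y`, followed by the shear by `f` and by `k ⊕ 𝟙`; the
braidings only move the fixed summand to the left. -/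
lemma inflation_lift {X Y Z : C} (f : X ⟶ Y) {k : X ⟶ Z} (hk : E.inflations k) :
    E.inflations (biprod.lift k f) := by
  have h := inflation_comp' (inflation_comp' (E.inflation_inl X Y)
    (inflation_of_iso (biprodShear f))) (inflation_comp'
      (inflation_of_iso (biprod.braiding X Y)) (inflation_comp' (inflation_biprod_map_id Y hk)
        (inflation_of_iso (biprod.braiding Y Z))))
  convert h using 1
  apply biprod.hom_ext <;> simp [biprod.braiding]

lemma deflation_desc {X Y Z : C} (f : X ⟶ Z) {k : Y ⟶ Z} (hk : E.deflations k) :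
    E.deflations (biprod.desc f k) := by
  have h := deflation_comp' (deflation_biprod_map_id X hk) (deflation_comp'
    (deflation_of_iso (biprodShear f)) (E.deflation_snd X Z))
  convert h using 1
  apply biprod.hom_ext' <;> simp

end Basic

/-! ### Weakly idempotent complete exact categories -/

section WeaklyIdempotentComplete

variable {C : Type u} [Category.{v} C] [Preadditive C] (E : ExactStructure C)

/-- A split monomorphism in a weakly idempotent complete category has a complement. -/
lemma _root_.WeaklyIdempotentComplete.exists_complement (hC : WeaklyIdempotentComplete C) {X Y : C}
    (s : X ⟶ Y) (r : Y ⟶ X) (hsr : s ≫ r = 𝟙 X) :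
    ∃ (Q : C) (c : Y ⟶ Q) (m : Q ⟶ Y), m ≫ c = 𝟙 Q ∧ m ≫ r = 0 ∧ s ≫ c = 0 ∧
      c ≫ m = 𝟙 Y - r ≫ s := by
  have := hC s ⟨⟨r, hsr⟩⟩
  have hcm : cokernel.π s ≫ cokernel.desc s (𝟙 Y - r ≫ s)
    (by simp [reassoc_of% hsr]) = 𝟙 Y - r ≫ s := by simp
  refine ⟨cokernel s, cokernel.π s, cokernel.desc s (𝟙 Y - r ≫ s)
    (by simp [reassoc_of% hsr]), ?_, ?_, by simp, hcm⟩
  · rw [← cancel_epi (cokernel.π s), reassoc_of% hcm]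
    simp
  · rw [← cancel_epi (cokernel.π s), reassoc_of% hcm]
    simp [hsr]

variable {E} [HasBinaryBiproducts C]

/-- A shear turns the inflation `(f, f ≫ g)` into `(f, 0) : X ⟶ Y ⊞ Z`. The summand `Z` still splits
off its cokernel `Q`, and the complement `R`, which exists by weak idempotent completeness, is a
cokernel of `f`. -/
lemma inflation_of_comp (hC : WeaklyIdempotentComplete C) {X Y Z : C} (f : X ⟶ Y) (g : Y ⟶ Z)
    (hfg : E.inflations (f ≫ g)) : E.inflations f := by
  have hj : E.inflations (f ≫ (biprod.inl : Y ⟶ Y ⊞ Z)) := by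
    have h := inflation_comp' (inflation_comp' (inflation_lift f hfg)
      (inflation_of_iso (biprod.braiding Z Y))) (inflation_of_iso (biprodShear (-g)))
    convert h using 1
    apply biprod.hom_ext <;> simp [biprod.braiding]
  obtain ⟨Q, q, w, h⟩ := hj
  have hm := conflation_mono h
  obtain ⟨r, hr⟩ := conflation_desc h biprod.snd (by simp)
  obtain ⟨R, c, m, hmc, hmr, -, hcm⟩ := hC.exists_complement (biprod.inr ≫ q) r (by simp [hr])
  have hp : ((biprod.inl : Y ⟶ Y ⊞ Z) ≫ q ≫ c) ≫ m = biprod.inl ≫ q := by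
    simp [hcm, reassoc_of% hr]
  have : Mono m := ⟨fun a b hab ↦ by
    simpa [hmc] using hab =≫ c⟩
  -- `Y` is the preimage under `q` of the summand `R`, so `Y ⟶ R` is a base change of a deflation.
  have hd : E.deflations ((biprod.inl : Y ⟶ Y ⊞ Z) ≫ q ≫ c) := by
    refine deflation_of_isPullback (p := q) (f := m) (g := biprod.inl) ?_ ⟨_, _, _, h⟩
    refine IsPullback.of_lift_of_hom_ext hp.symm (fun a b hab ↦ ?_) ?_
    · have ha : a ≫ biprod.snd = 0 := by
        rw [← hr, reassoc_of% hab, hmr, comp_zero]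
      have ha' : (a ≫ biprod.fst) ≫ biprod.inl = a := by
        apply biprod.hom_ext <;> simp [ha]
      refine ⟨a ≫ biprod.fst, ha', ?_⟩
      rw [← cancel_mono m, Category.assoc, hp, ← Category.assoc, ha', hab]
    · intro T l l' h₁ _
      simpa using h₁ =≫ biprod.fst
  have : Mono f := ⟨fun a b hab ↦ by
    rw [← cancel_mono (f ≫ (biprod.inl : Y ⟶ Y ⊞ Z)), reassoc_of% hab]⟩
  refine ⟨R, _, ?_, conflation_of_deflation ?_ hd ?_⟩
  · simpa using w =≫ c
  · simpa using w =≫ c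
  · intro T k hk
    obtain ⟨l, hl⟩ := conflation_lift h (k ≫ biprod.inl) (by
      rw [Category.assoc, ← hp, ← Category.assoc, hk, zero_comp])
    exact ⟨l, by simpa using hl =≫ biprod.fst⟩

/-- The dual argument: after a shear, `X` is a summand of the kernel `Q` of `(0, g) : X ⊞ Y ⟶ Z`,
and its complement `R` is a kernel of `g`. -/
lemma deflation_of_comp (hC : WeaklyIdempotentComplete C) {X Y Z : C} (f : X ⟶ Y) (g : Y ⟶ Z)
    (hfg : E.deflations (f ≫ g)) : E.deflations g := by
  have hj : E.deflations ((biprod.snd : X ⊞ Y ⟶ Y) ≫ g) := by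
    have h := deflation_comp' (deflation_of_iso (biprodShear (-f)))
      (deflation_comp' (deflation_of_iso (biprod.braiding X Y)) (deflation_desc g hfg))
    convert h using 1
    apply biprod.hom_ext' <;> simp [biprod.braiding]
  obtain ⟨Q, q, w, h⟩ := hj
  have he := conflation_epi h
  obtain ⟨s, hs⟩ := conflation_lift h biprod.inl (by simp)
  obtain ⟨R, c, m, hmc, -, hsc, hcm⟩ :=
    hC.exists_complement s (q ≫ biprod.fst) (by simp [reassoc_of% hs])
  have hp : c ≫ m ≫ q ≫ (biprod.snd : X ⊞ Y ⟶ Y) = q ≫ biprod.snd := by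
    simp [reassoc_of% hcm, reassoc_of% hs]
  have : Epi c := ⟨fun a b hab ↦ by
    simpa [reassoc_of% hmc] using m ≫= hab⟩
  have hd : E.inflations (m ≫ q ≫ (biprod.snd : X ⊞ Y ⟶ Y)) := by
    refine inflation_of_isPushout (i := q) (f := c) (g := biprod.snd) ?_ ⟨_, _, _, h⟩
    refine IsPushout.of_desc_of_hom_ext hp.symm (fun a b hab ↦ ?_) ?_
    · have ha : biprod.inl ≫ a = 0 := by
        rw [← hs, Category.assoc, hab, reassoc_of% hsc, zero_comp]
      have ha' : biprod.snd ≫ biprod.inr ≫ a = a := by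
        apply biprod.hom_ext' <;> simp [ha]
      refine ⟨biprod.inr ≫ a, ha', ?_⟩
      have := hp =≫ (biprod.inr ≫ a)
      simp only [Category.assoc] at this
      rw [← cancel_epi c, ← hab, Category.assoc, Category.assoc, this, ha']
    · intro T l l' h₁ _
      simpa using biprod.inr ≫= h₁
  have : Epi g := ⟨fun a b hab ↦ by
    rw [← cancel_epi ((biprod.snd : X ⊞ Y ⟶ Y) ≫ g), Category.assoc, hab, Category.assoc]⟩
  refine ⟨R, m ≫ q ≫ biprod.snd, ?_, conflation_of_inflation ?_ hd ?_⟩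
  · simpa using m ≫= w
  · simpa using m ≫= w
  · intro T k hk
    obtain ⟨l, hl⟩ := conflation_desc h (biprod.snd ≫ k) (by
      have := hp =≫ k
      simp only [Category.assoc] at this hk
      rw [← this, hk, comp_zero])
    exact ⟨l, by simpa using biprod.inr ≫= hl⟩

/-- The inclusion of sources is a split monomorphism, hence an inflation by cancellation. So `f`
followed by the inclusion of targets is an inflation, and `f` cancels too. -/
lemma inflations_isStableUnderRetracts (hC : WeaklyIdempotentComplete C) :
    E.inflations.IsStableUnderRetracts where
  of_retract {X Y Z W f g} h hg := by
    have h₁ : E.inflations h.i.left := inflation_of_comp hC _ h.r.left (by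
      rw [RetractArrow.retract_left]
      exact E.inflation_id _)
    refine inflation_of_comp hC _ h.i.right ?_
    rw [← h.i_w]
    exact inflation_comp' h₁ hg

lemma deflations_isStableUnderRetracts (hC : WeaklyIdempotentComplete C) :
    E.deflations.IsStableUnderRetracts where
  of_retract {X Y Z W f g} h hg := by
    have h₁ : E.deflations h.r.right := deflation_of_comp hC h.i.right _ (by
      rw [RetractArrow.retract_right]
      exact E.deflation_id _)
    refine deflation_of_comp hC h.r.left _ ?_
    rw [h.r_w]
    exact deflation_comp' hg h₁

end WeaklyIdempotentComplete

end ExactStructure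

/-! ### The stable category as an additive quotient -/

namespace ExactStructure

section Stable

variable {C : Type u} [Category.{v} C] [Preadditive C] {E : ExactStructure C}

lemma IsProjective.of_retract {P Q : C} (hP : E.IsProjective P) (s : Q ⟶ P) (r : P ⟶ Q)
    (h : s ≫ r = 𝟙 Q) : E.IsProjective Q := by
  intro Y Z p hp f
  obtain ⟨g, hg⟩ := hP p hp (r ≫ f)
  exact ⟨s ≫ g, by rw [Category.assoc, hg, reassoc_of% h]⟩

lemma IsProjective.of_isZero {P : C} (hP : IsZero P) : E.IsProjective P :=
  fun _ _ _ _ _ ↦ ⟨0, hP.eq_of_src _ _⟩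

lemma stableEquivalences_iff {X Y : C} (f : X ⟶ Y) :
    E.stableEquivalences f ↔ ∃ g : Y ⟶ X, E.toStable.map (f ≫ g) = 𝟙 _ ∧
      E.toStable.map (g ≫ f) = 𝟙 _ := by
  constructor
  · intro (h : IsIso (E.toStable.map f))
    obtain ⟨g, hg⟩ := E.toStable.map_surjective (inv (E.toStable.map f))
    exact ⟨g, by rw [Functor.map_comp, hg, IsIso.hom_inv_id],
      by rw [Functor.map_comp, hg, IsIso.inv_hom_id]⟩
  · rintro ⟨g, h₁, h₂⟩
    exact ⟨E.toStable.map g, by rw [← Functor.map_comp, h₁], by rw [← Functor.map_comp, h₂]⟩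

lemma IsProjective.isInjective {P : C} [E.IsFrobenius] (hP : E.IsProjective P) : E.IsInjective P :=
  (IsFrobenius.projective_iff_injective P).1 hP

lemma IsInjective.isProjective {P : C} [E.IsFrobenius] (hP : E.IsInjective P) : E.IsProjective P :=
  (IsFrobenius.projective_iff_injective P).2 hP

variable [HasBinaryBiproducts C]

lemma IsProjective.biprod {P Q : C} (hP : E.IsProjective P) (hQ : E.IsProjective Q) :
    E.IsProjective (P ⊞ Q) := by
  intro Y Z p hp f
  obtain ⟨g, hg⟩ := hP p hp (biprod.inl ≫ f)
  obtain ⟨g', hg'⟩ := hQ p hp (biprod.inr ≫ f)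
  exact ⟨biprod.desc g g', by apply biprod.hom_ext' <;> simp [hg, hg']⟩

lemma stableRel_add ⦃X Y : C⦄ (f₁ f₂ g₁ g₂ : X ⟶ Y) (hf : E.stableRel f₁ f₂)
    (hg : E.stableRel g₁ g₂) : E.stableRel (f₁ + g₁) (f₂ + g₂) := by
  obtain ⟨P, a, b, hP, h⟩ := hf
  obtain ⟨Q, c, d, hQ, h'⟩ := hg
  exact ⟨P ⊞ Q, biprod.lift a c, biprod.desc b d, hP.biprod hQ, by
    rw [biprod.lift_desc, ← h, ← h']; abel⟩

variable [HasZeroObject C]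

/-- Transitivity uses sums of projectives. Being a congruence guarantees that the quotient
identifies stably equal morphisms only. -/
instance : Congruence E.stableRel where
  comp_left f g g' h := by
    obtain ⟨P, a, b, hP, h⟩ := h
    exact ⟨P, f ≫ a, b, hP, by rw [← Preadditive.comp_sub, h, Category.assoc]⟩
  comp_right g h := by
    obtain ⟨P, a, b, hP, h⟩ := h
    exact ⟨P, a, b ≫ g, hP, by rw [← Preadditive.sub_comp, h, Category.assoc]⟩
  equivalence :=
    { refl f := ⟨_, 0, 0, .of_isZero (isZero_zero C), by simp⟩
      symm := by
        rintro f g ⟨P, a, b, hP, h⟩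
        exact ⟨P, -a, b, hP, by rw [Preadditive.neg_comp, ← h, neg_sub]⟩
      trans := by
        rintro f g k ⟨P, a, b, hP, h⟩ ⟨Q, c, d, hQ, h'⟩
        exact ⟨P ⊞ Q, biprod.lift a c, biprod.desc b d, hP.biprod hQ, by
          rw [biprod.lift_desc, ← h, ← h']; abel⟩ }

lemma toStable_map_eq_iff {X Y : C} (f g : X ⟶ Y) :
    E.toStable.map f = E.toStable.map g ↔ E.stableRel f g :=
  CategoryTheory.Quotient.functor_map_eq_iff _ _ _

lemma toStable_map_eq {X Y P : C} {f g : X ⟶ Y} (a : X ⟶ P) (b : P ⟶ Y)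
    (hP : E.IsProjective P) (h : f - g = a ≫ b) : E.toStable.map f = E.toStable.map g :=
  (toStable_map_eq_iff f g).2 ⟨P, a, b, hP, h⟩

instance : Preadditive E.Stable := CategoryTheory.Quotient.preadditive _ stableRel_add

instance : E.toStable.Additive := CategoryTheory.Quotient.functor_additive _ stableRel_add

lemma isZero_toStable_obj {P : C} (hP : E.IsProjective P) : IsZero (E.toStable.obj P) := by
  rw [IsZero.iff_id_eq_zero, ← E.toStable.map_id, ← E.toStable.map_zero]
  exact toStable_map_eq (𝟙 P) (𝟙 P) hP (by simp)

instance : HasZeroObject E.Stable :=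
  ⟨_, isZero_toStable_obj (.of_isZero (isZero_zero C))⟩

/-- An object is projective if its identity is stably zero. -/
lemma isProjective_of_stableRel {X : C} (h : E.toStable.map (𝟙 X) = E.toStable.map 0) :
    E.IsProjective X := by
  obtain ⟨P, a, b, hP, h⟩ := (toStable_map_eq_iff _ _).1 h
  exact hP.of_retract a b (by rw [← h, sub_zero])

lemma stableEquivalences_inr {X P : C} (hP : E.IsProjective P) :
    E.stableEquivalences (biprod.inr : X ⟶ P ⊞ X) := by
  refine (stableEquivalences_iff _).2 ⟨biprod.snd, by simp, ?_⟩
  rw [← E.toStable.map_id]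
  refine toStable_map_eq (-biprod.fst) biprod.inl hP ?_
  rw [sub_eq_iff_eq_add, ← biprod.total, Preadditive.neg_comp, neg_add_cancel_left]

lemma stableEquivalences_snd {X P : C} (hP : E.IsProjective P) :
    E.stableEquivalences (biprod.snd : P ⊞ X ⟶ X) := by
  refine (stableEquivalences_iff _).2 ⟨biprod.inr, ?_, by simp⟩
  rw [← E.toStable.map_id]
  refine toStable_map_eq (-biprod.fst) biprod.inl hP ?_
  rw [sub_eq_iff_eq_add, ← biprod.total, Preadditive.neg_comp, neg_add_cancel_left]

lemma stableEquivalences_inl {X P : C} (hP : E.IsProjective P) :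
    E.stableEquivalences (biprod.inl : X ⟶ X ⊞ P) := by
  refine (stableEquivalences_iff _).2 ⟨biprod.fst, by simp, ?_⟩
  rw [← E.toStable.map_id]
  refine toStable_map_eq (-biprod.snd) biprod.inr hP ?_
  rw [sub_eq_iff_eq_add, ← biprod.total, Preadditive.neg_comp, add_comm,
    add_neg_cancel_right]

lemma stableEquivalences_fst {X P : C} (hP : E.IsProjective P) :
    E.stableEquivalences (biprod.fst : X ⊞ P ⟶ X) := by
  refine (stableEquivalences_iff _).2 ⟨biprod.inl, ?_, by simp⟩
  rw [← E.toStable.map_id]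
  refine toStable_map_eq (-biprod.snd) biprod.inr hP ?_
  rw [sub_eq_iff_eq_add, ← biprod.total, Preadditive.neg_comp, add_comm,
    add_neg_cancel_right]

instance : E.stableEquivalences.HasTwoOutOfThreeProperty :=
  inferInstanceAs ((MorphismProperty.isomorphisms _).inverseImage _).HasTwoOutOfThreeProperty

instance : E.stableEquivalences.ContainsIdentities :=
  inferInstanceAs ((MorphismProperty.isomorphisms _).inverseImage _).ContainsIdentities

instance : E.stableEquivalences.IsStableUnderRetracts :=
  inferInstanceAs ((MorphismProperty.isomorphisms _).inverseImage _).IsStableUnderRetracts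

/-! ### The model structure -/

variable [E.IsFrobenius]

/-- An acyclic cofibration is a split inclusion with projective complement. -/
lemma exists_retraction_of_trivCof {X Y : C} (i : X ⟶ Y) (hi : E.inflations i)
    (hi' : E.stableEquivalences i) : ∃ (r : Y ⟶ X) (Z : C) (p : Y ⟶ Z) (m : Z ⟶ Y),
      i ≫ r = 𝟙 X ∧ p ≫ m = 𝟙 Y - r ≫ i ∧ i ≫ p = 0 ∧ E.IsProjective Z := by
  obtain ⟨g, h₁, h₂⟩ := (stableEquivalences_iff i).1 hi'
  obtain ⟨P, a, b, hP, hab⟩ := (toStable_map_eq_iff _ _).1 ((E.toStable.map_id X).trans h₁.symm)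
  -- `P` is also injective, so the defect `a ≫ b` of the stable inverse `g` extends along `i`, and
  -- `g + a' ≫ b` is a retraction on the nose.
  obtain ⟨a', rfl⟩ := hP.isInjective i hi a
  have hr : i ≫ (g + a' ≫ b) = 𝟙 X := by
    rw [Preadditive.comp_add, ← Category.assoc i a' b, ← hab]; abel
  generalize g + a' ≫ b = r at hr
  have hg : E.toStable.map r = E.toStable.map g := by
    have h₃ := E.toStable.congr_map hr
    rw [Functor.map_comp] at h₂ h₃
    rw [← Category.id_comp (E.toStable.map r), ← h₂, Category.assoc, h₃, E.toStable.map_id,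
      Category.comp_id]
  obtain ⟨Z, p, w, h⟩ := hi
  have := conflation_epi h
  obtain ⟨m, hm⟩ := conflation_desc h (𝟙 Y - r ≫ i) (by simp [reassoc_of% hr])
  refine ⟨r, Z, p, m, hr, hm, w, isProjective_of_stableRel ?_⟩
  have hmp : m ≫ p = 𝟙 Z := by
    rw [← cancel_epi p, reassoc_of% hm]
    simp [w]
  have : E.toStable.map (p ≫ m) = 0 := by
    rw [hm, Functor.map_sub, Functor.map_comp, hg, ← Functor.map_comp, h₂, E.toStable.map_id]
    simp
  -- The idempotent `p ≫ m = 𝟙 Y - r ≫ i` is stably zero because `r` is a stable inverse of `i`, and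
  -- the identity of `Z` factors through it.
  have hZ : 𝟙 Z = m ≫ (p ≫ m) ≫ p := by simp [hmp]
  rw [hZ, Functor.map_comp, Functor.map_comp, this, zero_comp, comp_zero, Functor.map_zero]

/-- An acyclic fibration is a split projection with injective kernel. -/
lemma exists_section_of_trivFib {X Y : C} (p : X ⟶ Y) (hp : E.deflations p)
    (hp' : E.stableEquivalences p) : ∃ (s : Y ⟶ X) (K : C) (k : K ⟶ X) (t : X ⟶ K),
      s ≫ p = 𝟙 Y ∧ t ≫ k = 𝟙 X - p ≫ s ∧ k ≫ p = 0 ∧ E.IsInjective K := by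
  obtain ⟨g, h₁, h₂⟩ := (stableEquivalences_iff p).1 hp'
  obtain ⟨P, a, b, hP, hab⟩ := (toStable_map_eq_iff _ _).1 ((E.toStable.map_id Y).trans h₂.symm)
  obtain ⟨b', rfl⟩ := hP p hp b
  have hs : (g + a ≫ b') ≫ p = 𝟙 Y := by
    rw [Preadditive.add_comp, Category.assoc, ← hab]; abel
  generalize g + a ≫ b' = s at hs
  have hg : E.toStable.map s = E.toStable.map g := by
    have h₃ := E.toStable.congr_map hs
    rw [Functor.map_comp] at h₁ h₃
    rw [← Category.comp_id (E.toStable.map s), ← h₁, ← Category.assoc, h₃, E.toStable.map_id,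
      Category.id_comp]
  obtain ⟨K, k, w, h⟩ := hp
  have := conflation_mono h
  obtain ⟨t, ht⟩ := conflation_lift h (𝟙 X - p ≫ s) (by simp [hs])
  refine ⟨s, K, k, t, hs, ht, w, IsProjective.isInjective (isProjective_of_stableRel ?_)⟩
  have hkt : k ≫ t = 𝟙 K := by
    rw [← cancel_mono k, Category.assoc, ht]
    simp [reassoc_of% w]
  have : E.toStable.map (t ≫ k) = 0 := by
    rw [ht, Functor.map_sub, Functor.map_comp, hg, ← Functor.map_comp, h₁, E.toStable.map_id]
    simp
  have hK : 𝟙 K = k ≫ (t ≫ k) ≫ t := by simp [hkt]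
  rw [hK, Functor.map_comp, Functor.map_comp, this, zero_comp, comp_zero, Functor.map_zero]

/-- Along the splitting of `i`, use `u` on `A` and, on the projective complement, a lift of `v`
through `p`. -/
lemma hasLiftingProperty_of_trivCof {A B X Y : C} (i : A ⟶ B) (p : X ⟶ Y) (hi : E.inflations i)
    (hi' : E.stableEquivalences i) (hp : E.deflations p) : HasLiftingProperty i p where
  sq_hasLift {u v} sq := by
    obtain ⟨r, Z, q, m, hr, hm, hq, hZ⟩ := exists_retraction_of_trivCof i hi hi'
    obtain ⟨w, hw⟩ := hZ p hp (m ≫ v)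
    refine ⟨⟨r ≫ u + q ≫ w, ?_, ?_⟩⟩
    · simp [reassoc_of% hr, reassoc_of% hq]
    · simp [hw, reassoc_of% hm, sq.w]

/-- Use `v` followed by the section, plus an extension along `i` of the component of `u` in the
injective kernel. -/
lemma hasLiftingProperty_of_trivFib {A B X Y : C} (i : A ⟶ B) (p : X ⟶ Y) (hi : E.inflations i)
    (hp : E.deflations p) (hp' : E.stableEquivalences p) : HasLiftingProperty i p where
  sq_hasLift {u v} sq := by
    obtain ⟨s, K, k, t, hs, ht, hk, hK⟩ := exists_section_of_trivFib p hp hp'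
    obtain ⟨w, hw⟩ := hK i hi (u ≫ t)
    refine ⟨⟨v ≫ s + w ≫ k, ?_, ?_⟩⟩
    · simp [reassoc_of% hw, ht, reassoc_of% sq.w]
    · simp [hs, hk]

lemma exists_fac_trivCof {X Y : C} (f : X ⟶ Y) : ∃ (Z : C) (i : X ⟶ Z) (p : Z ⟶ Y),
    i ≫ p = f ∧ E.inflations i ∧ E.stableEquivalences i ∧ E.deflations p := by
  obtain ⟨P, p, hP, hp⟩ := IsFrobenius.enough_projectives (E := E) Y
  exact ⟨X ⊞ P, biprod.inl, biprod.desc f p, by simp, E.inflation_inl _ _,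
    stableEquivalences_inl hP, deflation_desc f hp⟩

/-- Adding an injective object containing `X` to the target makes `f` an inflation; the projection
back is acyclic because injectives are projective. -/
lemma exists_fac_trivFib {X Y : C} (f : X ⟶ Y) : ∃ (Z : C) (i : X ⟶ Z) (p : Z ⟶ Y),
    i ≫ p = f ∧ E.inflations i ∧ E.deflations p ∧ E.stableEquivalences p := by
  obtain ⟨I, i, hI, hi⟩ := IsFrobenius.enough_injectives (E := E) X
  exact ⟨I ⊞ Y, biprod.lift i f, biprod.snd, by simp, inflation_lift f hi,
    E.deflation_snd _ _, stableEquivalences_snd hI.isProjective⟩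

variable (E)

lemma isClosedModel_model (hC : WeaklyIdempotentComplete C) : E.model.IsClosedModel where
  hasInitial := inferInstance
  hasTerminal := inferInstance
  hasPushout i f hi := by
    obtain ⟨_, _, _, sq, _⟩ := E.exists_pushout i f hi
    exact sq.hasPushout
  hasPullback p f hp := by
    obtain ⟨_, _, _, sq, _⟩ := E.exists_pullback p f hp
    exact sq.hasPullback
  two_out_of_three := inferInstanceAs E.stableEquivalences.HasTwoOutOfThreeProperty
  retract_weq := inferInstanceAs E.stableEquivalences.IsStableUnderRetracts
  retract_cof := inflations_isStableUnderRetracts hC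
  retract_fib := deflations_isStableUnderRetracts hC
  lift_trivCof := hasLiftingProperty_of_trivCof
  lift_trivFib := hasLiftingProperty_of_trivFib
  fac_trivCof := ⟨fun f ↦ by
    obtain ⟨Z, i, p, h, h₁, h₂, h₃⟩ := exists_fac_trivCof (E := E) f
    exact ⟨⟨Z, i, p, h, ⟨h₁, h₂⟩, h₃⟩⟩⟩
  fac_trivFib := ⟨fun f ↦ by
    obtain ⟨Z, i, p, h, h₁, h₂, h₃⟩ := exists_fac_trivFib (E := E) f
    exact ⟨⟨Z, i, p, h, h₁, ⟨h₂, h₃⟩⟩⟩⟩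

end Stable

end ExactStructure

/-! ### Coslice categories -/

section Under

variable {M : Type*} [Category* M] {A : M}

lemma CategoryTheory.Under.isPushout_of_isPushout_right {U V W P : Under A} {f : U ⟶ V}
    {g : U ⟶ W} {inl : V ⟶ P} {inr : W ⟶ P}
    (sq : IsPushout f.right g.right inl.right inr.right) : IsPushout f g inl inr := by
  refine IsPushout.of_desc_of_hom_ext (by ext; exact sq.w) (fun {T} a b hab ↦ ?_) ?_
  · refine ⟨Under.homMk (sq.desc a.right b.right (congr_arg CommaMorphism.right hab)) ?_,
      ?_, ?_⟩
    · rw [← Under.w inl, Category.assoc, sq.inl_desc, Under.w a]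
    · ext
      exact sq.inl_desc _ _ _
    · ext
      exact sq.inr_desc _ _ _
  · intro T l l' h₁ h₂
    ext
    exact sq.hom_ext (congr_arg CommaMorphism.right h₁) (congr_arg CommaMorphism.right h₂)

lemma CategoryTheory.Under.exists_isPushout {U V W : Under A} (f : U ⟶ V) (g : U ⟶ W)
    [HasPushout f.right g.right] : ∃ (P : Under A) (inl : V ⟶ P) (inr : W ⟶ P),
      IsPushout f.right g.right inl.right inr.right := by
  refine ⟨Under.mk (V.hom ≫ pushout.inl f.right g.right), Under.homMk (pushout.inl _ _),
    Under.homMk (pushout.inr _ _) ?_, IsPushout.of_hasPushout _ _⟩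
  rw [← Under.w f, ← Under.w g, Category.assoc, Category.assoc, pushout.condition]
  rfl

/-- A pushout of the underlying morphisms underlies a pushout in the coslice category, and pushouts
are unique. This lets cofibre sequences of `(A ↓ C)` be read in `C`. -/
lemma CategoryTheory.Under.isPushout_right {U V W P : Under A} {f : U ⟶ V} {g : U ⟶ W}
    {inl : V ⟶ P} {inr : W ⟶ P} (sq : IsPushout f g inl inr) [HasPushout f.right g.right] :
    IsPushout f.right g.right inl.right inr.right := by
  obtain ⟨P', inl', inr', sq'⟩ := Under.exists_isPushout f g
  let e := (Under.isPushout_of_isPushout_right sq').isoIsPushout _ _ sq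
  refine sq'.of_iso (Iso.refl _) (Iso.refl _) (Iso.refl _) ((Under.forget A).mapIso e)
    (by simp) (by simp) ?_ ?_
  · change (inl' ≫ e.hom).right = (𝟙 _ ≫ inl).right
    rw [Category.id_comp, IsPushout.inl_isoIsPushout_hom]
  · change (inr' ≫ e.hom).right = (𝟙 _ ≫ inr).right
    rw [Category.id_comp, IsPushout.inr_isoIsPushout_hom]

lemma CategoryTheory.Under.hasPullback {U V W : Under A} (f : U ⟶ W) (g : V ⟶ W)
    [HasPullback f.right g.right] : HasPullback f g := by
  let P : Under A := Under.mk (pullback.lift U.hom V.hom (by rw [Under.w f, Under.w g]))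
  let fst : P ⟶ U := Under.homMk (pullback.fst f.right g.right) (pullback.lift_fst _ _ _)
  let snd : P ⟶ V := Under.homMk (pullback.snd f.right g.right) (pullback.lift_snd _ _ _)
  have sq : IsPullback fst snd f g := by
    refine IsPullback.of_lift_of_hom_ext (by ext; exact pullback.condition)
      (fun {T} a b hab ↦ ?_) ?_
    · refine ⟨Under.homMk (pullback.lift a.right b.right (congr_arg CommaMorphism.right hab)) ?_,
        ?_, ?_⟩
      · apply pullback.hom_ext
        · rw [Category.assoc, pullback.lift_fst, Under.w a]
          exact (pullback.lift_fst _ _ _).symm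
        · rw [Category.assoc, pullback.lift_snd, Under.w b]
          exact (pullback.lift_snd _ _ _).symm
      · ext
        exact pullback.lift_fst _ _ _
      · ext
        exact pullback.lift_snd _ _ _
    · intro T l l' h₁ h₂
      ext
      exact pullback.hom_ext (congr_arg CommaMorphism.right h₁)
        (congr_arg CommaMorphism.right h₂)
  exact sq.hasPullback

lemma CategoryTheory.Under.hasLiftingProperty {U V X Y : Under A} (i : U ⟶ V) (p : X ⟶ Y)
    (h : HasLiftingProperty i.right p.right) : HasLiftingProperty i p where
  sq_hasLift {u v} sq := by
    have sq' : CommSq u.right i.right p.right v.right :=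
      ⟨congr_arg CommaMorphism.right sq.w⟩
    refine ⟨⟨Under.homMk sq'.lift ?_, ?_, ?_⟩⟩
    · rw [← Under.w i, Category.assoc, sq'.fac_left, Under.w u]
    · ext
      exact sq'.fac_left
    · ext
      exact sq'.fac_right

lemma CategoryTheory.Under.hasTerminal [HasTerminal M] : HasTerminal (Under A) :=
  IsTerminal.hasTerminal (X := Under.mk (terminal.from A)) <|
    IsTerminal.ofUniqueHom (fun U ↦ Under.homMk (terminal.from U.right) (terminal.hom_ext _ _))
      (fun U m ↦ by ext; exact terminal.hom_ext _ _)

lemma CategoryTheory.Under.hasFactorization {W₁ W₂ : MorphismProperty M}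
    [W₁.HasFactorization W₂] :
    (W₁.inverseImage (Under.forget A)).HasFactorization (W₂.inverseImage (Under.forget A)) where
  nonempty_mapFactorizationData {U V} f := by
    let d := W₁.factorizationData W₂ f.right
    exact ⟨⟨Under.mk (U.hom ≫ d.i), Under.homMk d.i, Under.homMk d.p (by simp),
      by ext; exact d.fac, d.hi, d.hp⟩⟩

lemma ModelClasses.IsClosedModel.under {m : ModelClasses M} (h : m.IsClosedModel) (A : M) :
    (m.under A).IsClosedModel where
  hasInitial := Under.mkIdInitial.hasInitial
  hasTerminal :=
    have := h.hasTerminal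
    Under.hasTerminal
  hasPushout i f hi := by
    have := h.hasPushout i.right f.right hi
    obtain ⟨_, _, _, sq⟩ := Under.exists_isPushout i f
    exact (Under.isPushout_of_isPushout_right sq).hasPushout
  hasPullback p f hp := by
    have := h.hasPullback p.right f.right hp
    exact Under.hasPullback p f
  two_out_of_three :=
    have := h.two_out_of_three
    inferInstanceAs (m.weq.inverseImage _).HasTwoOutOfThreeProperty
  retract_weq :=
    have := h.retract_weq
    inferInstanceAs (m.weq.inverseImage _).IsStableUnderRetracts
  retract_cof :=
    have := h.retract_cof
    inferInstanceAs (m.cof.inverseImage _).IsStableUnderRetracts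
  retract_fib :=
    have := h.retract_fib
    inferInstanceAs (m.fib.inverseImage _).IsStableUnderRetracts
  lift_trivCof i p hi hi' hp := Under.hasLiftingProperty i p (h.lift_trivCof _ _ hi hi' hp)
  lift_trivFib i p hi hp hp' := Under.hasLiftingProperty i p (h.lift_trivFib _ _ hi hp hp')
  fac_trivCof :=
    have := h.fac_trivCof
    Under.hasFactorization (W₁ := m.cof ⊓ m.weq)
  fac_trivFib :=
    have := h.fac_trivFib
    Under.hasFactorization (W₂ := m.fib ⊓ m.weq)

end Under

namespace ExactStructure

variable {C : Type u} [Category.{v} C] [Preadditive C] [HasBinaryBiproducts C] [HasZeroObject C]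
  {E : ExactStructure C}

/-! ### The Quillen equivalence -/

section Quillen

variable {A : C}

lemma stableEquivalences_zeroShriek_map (hA : E.IsProjective A) {X Y : C} (f : X ⟶ Y) :
    E.stableEquivalences ((zeroShriek A).map f).right ↔ E.stableEquivalences f := by
  have h : (biprod.inr : X ⟶ A ⊞ X) ≫ biprod.map (𝟙 A) f = f ≫ biprod.inr := by simp
  change E.stableEquivalences (biprod.map (𝟙 A) f) ↔ _
  rw [← E.stableEquivalences.precomp_iff _ _ (stableEquivalences_inr (X := X) hA), h,
    E.stableEquivalences.postcomp_iff _ _ (stableEquivalences_inr (X := Y) hA)]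

omit [HasZeroObject C] in
lemma zeroShriekAdj_homEquiv (X : C) (Y : Under A) (f : (zeroShriek A).obj X ⟶ Y) :
    (zeroShriekAdj A).homEquiv X Y f = biprod.inr ≫ f.right := by
  simp only [zeroShriekAdj, Adjunction.mkOfHomEquiv_homEquiv]
  rfl

/-- The adjunct is `f.right` preceded by `biprod.inr`, a stable equivalence. Applied to an identity
and to the counit, this shows that unit and counit are weak equivalences. -/
lemma stableEquivalences_zeroShriekAdj_homEquiv_iff (hA : E.IsProjective A) (X : C) (Y : Under A)
    (f : (zeroShriek A).obj X ⟶ Y) :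
    E.stableEquivalences ((zeroShriekAdj A).homEquiv X Y f) ↔ E.stableEquivalences f.right := by
  rw [zeroShriekAdj_homEquiv]
  exact E.stableEquivalences.precomp_iff _ _ (stableEquivalences_inr hA)

lemma isQuillenEquivalence (hA : E.IsProjective A) :
    ModelClasses.IsQuillenEquivalence E.model (E.model.under A) (zeroShriekAdj A) where
  map_cof _ hf := inflation_biprod_map_id A hf
  map_trivCof _ hf hf' := ⟨inflation_biprod_map_id A hf,
    (stableEquivalences_zeroShriek_map hA _).2 hf'⟩
  weq_iff X Y _ _ _ := (stableEquivalences_zeroShriekAdj_homEquiv_iff hA X Y _).symm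

lemma stableEquivalences_zeroShriekAdj_unit (hA : E.IsProjective A) (X : C) :
    E.stableEquivalences ((zeroShriekAdj A).unit.app X) := by
  rw [← Adjunction.homEquiv_id]
  exact (stableEquivalences_zeroShriekAdj_homEquiv_iff hA _ _ _).2 (E.stableEquivalences.id_mem _)

lemma stableEquivalences_zeroShriekAdj_counit (hA : E.IsProjective A) (U : Under A) :
    E.stableEquivalences ((zeroShriekAdj A).counit.app U).right := by
  rw [← stableEquivalences_zeroShriekAdj_homEquiv_iff hA, Adjunction.homEquiv_unit,
    Adjunction.right_triangle_components]
  exact E.stableEquivalences.id_mem _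

end Quillen

/-! ### The stable category is a localization -/

section Localization

/-- The maps `(1, 0)` and `(1, a)` from `X` to `X ⊞ P` are sections of the same stable equivalence
`biprod.fst`, so `F` identifies them; composing with `(g, b)` yields `g` and `f`. -/
lemma map_eq_of_stableRel {D : Type*} [Category* D] (F : C ⥤ D)
    (hF : E.stableEquivalences.IsInvertedBy F) {X Y : C} {f g : X ⟶ Y} (h : E.stableRel f g) :
    F.map f = F.map g := by
  obtain ⟨P, a, b, hP, hab⟩ := h
  have : IsIso (F.map (biprod.fst : X ⊞ P ⟶ X)) := hF _ (stableEquivalences_fst hP)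
  have key : F.map (biprod.lift (𝟙 X) (0 : X ⟶ P)) = F.map (biprod.lift (𝟙 X) a) := by
    rw [← cancel_mono (F.map (biprod.fst : X ⊞ P ⟶ X)), ← F.map_comp, ← F.map_comp]
    simp
  have hf : f = biprod.lift (𝟙 X) a ≫ biprod.desc g b := by
    simp [← hab]
  have hg : g = biprod.lift (𝟙 X) (0 : X ⟶ P) ≫ biprod.desc g b := by
    simp
  conv_lhs => rw [hf]
  conv_rhs => rw [hg]
  rw [F.map_comp, F.map_comp, key]

variable (E) in
/-- The strict universal property of the stable category. -/
def toStableStrictUniversalProperty (D : Type*) [Category* D] :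
    Localization.StrictUniversalPropertyFixedTarget E.toStable E.stableEquivalences D where
  inverts _ _ _ hf := hf
  lift F hF := CategoryTheory.Quotient.lift _ F fun _ _ _ _ h ↦ map_eq_of_stableRel F hF h
  fac _ _ := CategoryTheory.Quotient.lift_spec _ _ _
  uniq _ _ h := CategoryTheory.Quotient.lift_unique' _ _ _ h

instance : E.toStable.IsLocalization E.stableEquivalences :=
  Functor.IsLocalization.mk' _ _ (E.toStableStrictUniversalProperty _)
    (E.toStableStrictUniversalProperty _)

end Localization

end ExactStructure

namespace CategoryTheory

/-! ### Shifts from an autoequivalence -/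

section Spectrum

variable {D : Type*} [Category* D] (S : D ⥤ D)

/-- A sequence of objects indexed by the integers in which every object is identified to the
image by `S` of the previous one. -/
structure FunctorSpectrum where
  obj : ℤ → D
  iso (i j : ℤ) (h : i + 1 = j) : S.obj (obj i) ≅ obj j

namespace FunctorSpectrum

variable {S}

@[ext]
structure Hom (X Y : FunctorSpectrum S) where
  app (i : ℤ) : X.obj i ⟶ Y.obj i
  comm (i j : ℤ) (h : i + 1 = j) :
    (X.iso i j h).hom ≫ app j = S.map (app i) ≫ (Y.iso i j h).hom := by cat_disch

attribute [simp] Hom.comm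

@[simp]
lemma Hom.comm_assoc {X Y : FunctorSpectrum S} (f : Hom X Y) (i j : ℤ) (h : i + 1 = j) {Z : D}
    (k : Y.obj j ⟶ Z) :
    (X.iso i j h).hom ≫ f.app j ≫ k = S.map (f.app i) ≫ (Y.iso i j h).hom ≫ k := by
  rw [← Category.assoc, f.comm, Category.assoc]

instance : Category (FunctorSpectrum S) where
  Hom := Hom
  id X := { app i := 𝟙 _ }
  comp f g := { app i := f.app i ≫ g.app i }

@[simp]
lemma id_app (X : FunctorSpectrum S) (i : ℤ) : Hom.app (𝟙 X) i = 𝟙 (X.obj i) := rfl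

@[simp]
lemma comp_app {X Y Z : FunctorSpectrum S} (f : X ⟶ Y) (g : Y ⟶ Z) (i : ℤ) :
    (f ≫ g).app i = f.app i ≫ g.app i := rfl

@[ext]
lemma hom_ext {X Y : FunctorSpectrum S} {f g : X ⟶ Y} (h : ∀ i, f.app i = g.app i) : f = g :=
  Hom.ext (funext h)

variable (S) in
/-- The shift of the indices. -/
@[simps]
def shift (n : ℤ) : FunctorSpectrum S ⥤ FunctorSpectrum S where
  obj X :=
    { obj i := X.obj (i + n)
      iso i j h := X.iso (i + n) (j + n) (by lia) }
  map f := { app i := f.app (i + n) }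

lemma iso_eqToHom (X : FunctorSpectrum S) {i j i' j' : ℤ} (h : i + 1 = j) (hi : i = i')
    (hj : j = j') (h' : i' + 1 = j') :
    (X.iso i j h).hom ≫ eqToHom (congr_arg X.obj hj) =
      S.map (eqToHom (congr_arg X.obj hi)) ≫ (X.iso i' j' h').hom := by
  subst hi hj
  simp

lemma app_eqToHom {X Y : FunctorSpectrum S} (f : X ⟶ Y) {i j : ℤ} (h : i = j) :
    f.app i ≫ eqToHom (congr_arg Y.obj h) = eqToHom (congr_arg X.obj h) ≫ f.app j := by
  subst h
  simp

/-- Constructor for isomorphisms. -/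
@[simps]
def isoMk {X Y : FunctorSpectrum S} (e : ∀ i, X.obj i ≅ Y.obj i)
    (comm : ∀ (i j : ℤ) (h : i + 1 = j),
      (X.iso i j h).hom ≫ (e j).hom = S.map (e i).hom ≫ (Y.iso i j h).hom) : X ≅ Y where
  hom := { app i := (e i).hom }
  inv :=
    { app i := (e i).inv
      comm i j h := by
        rw [← cancel_mono (e j).hom, Category.assoc, Category.assoc, comm, Iso.inv_hom_id,
          Category.comp_id, ← Functor.map_comp_assoc, Iso.inv_hom_id, Functor.map_id,
          Category.id_comp] }

variable (S) in
/-- The shift by zero. -/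
@[simps!]
def shiftZero : shift S 0 ≅ 𝟭 _ :=
  NatIso.ofComponents
    (fun X ↦ isoMk (fun i ↦ eqToIso (congr_arg X.obj (add_zero i)))
      (fun i j h ↦ X.iso_eqToHom _ (add_zero i) (add_zero j) h))
    (fun f ↦ by
      ext i
      exact app_eqToHom f (add_zero i))

variable (S) in
/-- The shift by a sum. -/
@[simps!]
def shiftAdd (n m : ℤ) : shift S (n + m) ≅ shift S n ⋙ shift S m :=
  NatIso.ofComponents
    (fun X ↦ isoMk (fun i ↦ eqToIso (congr_arg X.obj (by lia : i + (n + m) = i + m + n)))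
      (fun i j h ↦ X.iso_eqToHom _ (by lia) (by lia) (by lia)))
    (fun f ↦ by
      ext i
      exact app_eqToHom f (by lia : i + (n + m) = i + m + n))

lemma eqToHom_app {X Y : FunctorSpectrum S} (h : X = Y) (i : ℤ) :
    (eqToHom h : X ⟶ Y).app i = eqToHom (by rw [h]) := by
  subst h
  rfl

instance : HasShift (FunctorSpectrum S) ℤ := hasShiftMk _ _
  { F := shift S
    zero := shiftZero S
    add := shiftAdd S
    assoc_hom_app n m p X := by
      ext i
      simp [eqToHom_app]
      exact (eqToHom_trans _ _).trans (.symm (.trans (congr_arg _ (eqToHom_trans _ _))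
        (eqToHom_trans _ _)))
    zero_add_hom_app n X := by
      ext i
      simp [eqToHom_app]
      exact (eqToHom_trans _ _).symm
    add_zero_hom_app n X := by
      ext i
      simp [eqToHom_app]
      exact (eqToHom_trans _ _).symm }

variable (S) in
/-- The evaluation at the index zero. -/
@[simps]
def eval : FunctorSpectrum S ⥤ D where
  obj X := X.obj 0
  map f := f.app 0

variable (S) in
/-- On the object of index zero, the shift by one is `S`. -/
def evalShiftIso : shiftFunctor (FunctorSpectrum S) (1 : ℤ) ⋙ eval S ≅ eval S ⋙ S :=
  NatIso.ofComponents (fun X ↦ (X.iso 0 (0 + 1) rfl).symm) (fun {X Y} f ↦ by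
    have h := f.comm 0 (0 + 1) rfl
    change f.app (0 + 1) ≫ (Y.iso 0 (0 + 1) rfl).inv = (X.iso 0 (0 + 1) rfl).inv ≫ S.map (f.app 0)
    rw [Iso.comp_inv_eq, Category.assoc, Iso.eq_inv_comp, h])

/-- Induction in both directions from the index zero: upwards along the structure isomorphisms,
downwards by faithfulness of `S`. Fullness and essential surjectivity are built by the same
two-sided recursion. -/
instance [S.Faithful] : (eval S).Faithful where
  map_injective {X Y f g} (h : f.app 0 = g.app 0) := by
    ext i
    induction i using Int.induction_on with
    | zero => exact h
    | succ k hk =>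
      rw [← cancel_epi (X.iso k (k + 1) rfl).hom, f.comm, g.comm, hk]
    | pred k hk =>
      apply S.map_injective
      rw [← cancel_mono (Y.iso (-k - 1) (-k) (by lia)).hom, ← f.comm, ← g.comm, hk]

instance [S.Full] [S.Faithful] : (eval S).Full where
  map_surjective {X Y} (f : X.obj 0 ⟶ Y.obj 0) := by
    let app (i : ℤ) : X.obj i ⟶ Y.obj i := Int.inductionOn' i 0 f
      (fun k _ g ↦ (X.iso k (k + 1) rfl).inv ≫ S.map g ≫ (Y.iso k (k + 1) rfl).hom)
      (fun k _ g ↦ S.preimage ((X.iso (k - 1) k (by lia)).hom ≫ g ≫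
        (Y.iso (k - 1) k (by lia)).inv))
    refine ⟨{ app := app, comm := ?_ }, ?_⟩
    · intro i j h
      by_cases hi : 0 ≤ i
      · subst h
        have : app (i + 1) = _ := Int.inductionOn'_add_one hi
        rw [this, Iso.hom_inv_id_assoc]
      · obtain rfl : i = j - 1 := by lia
        have : app (j - 1) = _ := Int.inductionOn'_sub_one (by lia : j ≤ 0)
        rw [this, Functor.map_preimage, Category.assoc, Category.assoc, Iso.inv_hom_id,
          Category.comp_id]
    · change app 0 = f
      exact Int.inductionOn'_self

instance [S.EssSurj] : (eval S).EssSurj where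
  mem_essImage X := by
    let obj (i : ℤ) : D := Int.inductionOn' i 0 X (fun _ _ Y ↦ S.obj Y) (fun _ _ Y ↦ S.objPreimage Y)
    refine ⟨{ obj := obj, iso := fun i j h ↦ if hi : 0 ≤ i then ?_ else ?_ }, ⟨eqToIso ?_⟩⟩
    · refine eqToIso ?_
      subst h
      exact (Int.inductionOn'_add_one hi).symm
    · refine S.mapIso (eqToIso ?_) ≪≫ S.objObjPreimageIso (obj j)
      obtain rfl : i = j - 1 := by lia
      exact Int.inductionOn'_sub_one (by lia : j ≤ 0)
    · change obj 0 = X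
      exact Int.inductionOn'_self

instance [S.IsEquivalence] : (eval S).IsEquivalence where

end FunctorSpectrum

/-- Negative powers of `S` exist only up to isomorphism, so coherence is not free. On spectra the
shift is a reindexing whose coherence isomorphisms are all `eqToHom`; it is transported along the
equivalence `eval S`. -/
lemma exists_hasShift_of_isEquivalence [S.IsEquivalence] :
    ∃ _ : HasShift D ℤ, Nonempty (shiftFunctor D (1 : ℤ) ≅ S) := by
  let e := (FunctorSpectrum.eval S).asEquivalence
  let s (n : ℤ) : D ⥤ D := e.inverse ⋙ shiftFunctor (FunctorSpectrum S) n ⋙ e.functor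
  let i (n : ℤ) : s n ⋙ e.inverse ≅ e.inverse ⋙ shiftFunctor (FunctorSpectrum S) n :=
    Functor.associator _ _ _ ≪≫ Functor.isoWhiskerLeft e.inverse (Functor.associator _ _ _ ≪≫
      Functor.isoWhiskerLeft _ e.unitIso.symm ≪≫ Functor.rightUnitor _)
  refine ⟨e.fullyFaithfulInverse.hasShift s i, ⟨?_⟩⟩
  exact Functor.isoWhiskerLeft e.inverse (FunctorSpectrum.evalShiftIso S) ≪≫
    (Functor.associator _ _ _).symm ≪≫ Functor.isoWhiskerRight e.counitIso S ≪≫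
      Functor.leftUnitor S

end Spectrum

/-- If the shift by one is additive, then all shift functors are. -/
lemma additive_shiftFunctor_of_one {D : Type*} [Category* D] [Preadditive D] [HasShift D ℤ]
    [(shiftFunctor D (1 : ℤ)).Additive] (n : ℤ) : (shiftFunctor D n).Additive := by
  induction n using Int.induction_on with
  | zero => exact Functor.additive_of_iso (shiftFunctorZero D ℤ).symm
  | succ k hk => exact Functor.additive_of_iso (shiftFunctorAdd D (k : ℤ) 1).symm
  | pred k hk =>
    have : (shiftFunctor D (-k - 1 : ℤ) ⋙ shiftFunctor D (1 : ℤ)).Additive :=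
      Functor.additive_of_iso (shiftFunctorAdd' D (-k - 1 : ℤ) 1 (-k) (by lia))
    exact Functor.additive_of_comp_faithful _ (shiftFunctor D (1 : ℤ))

end CategoryTheory

namespace CategoryTheory

/-! ### Triangulated structures from forward rotations of triangles -/

section ForwardRotation

open Pretriangulated ZeroObject

variable {D : Type*} [Category* D] [Preadditive D] [HasZeroObject D] [HasShift D ℤ]
  [∀ n : ℤ, (shiftFunctor D n).Additive]

/-- The axioms of a pretriangulated category, except that one does not require that a triangle is
distinguished when its rotation is. -/
structure IsForwardPretriangulated (Δ : Set (Triangle D)) : Prop where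
  of_iso : ∀ T₁ ∈ Δ, ∀ (T₂) (_ : T₂ ≅ T₁), T₂ ∈ Δ
  contractible : ∀ X : D, contractibleTriangle X ∈ Δ
  cocone : ∀ {X Y : D} (f : X ⟶ Y),
    ∃ (Z : D) (g : Y ⟶ Z) (h : Z ⟶ X⟦(1 : ℤ)⟧), Triangle.mk f g h ∈ Δ
  rotate : ∀ T ∈ Δ, T.rotate ∈ Δ
  complete : ∀ (T₁ T₂ : Triangle D) (_ : T₁ ∈ Δ) (_ : T₂ ∈ Δ)
    (a : T₁.obj₁ ⟶ T₂.obj₁) (b : T₁.obj₂ ⟶ T₂.obj₂) (_ : T₁.mor₁ ≫ b = a ≫ T₂.mor₁),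
    ∃ c : T₁.obj₃ ⟶ T₂.obj₃, T₁.mor₂ ≫ c = b ≫ T₂.mor₂ ∧ T₁.mor₃ ≫ a⟦1⟧' = c ≫ T₂.mor₃

namespace IsForwardPretriangulated

variable {Δ : Set (Triangle D)} (hΔ : IsForwardPretriangulated Δ)
include hΔ

omit [∀ n : ℤ, (shiftFunctor D n).Additive] in
lemma comp_zero₁₂ {T : Triangle D} (hT : T ∈ Δ) : T.mor₁ ≫ T.mor₂ = 0 := by
  obtain ⟨c, hc, -⟩ := hΔ.complete _ _ (hΔ.contractible T.obj₁) hT (𝟙 T.obj₁) T.mor₁ rfl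
  exact hc.symm.trans zero_comp

omit [∀ n : ℤ, (shiftFunctor D n).Additive] in
lemma comp_zero₃₁ {T : Triangle D} (hT : T ∈ Δ) : T.mor₃ ≫ T.mor₁⟦(1 : ℤ)⟧' = 0 := by
  have h : T.mor₃ ≫ (-T.mor₁⟦(1 : ℤ)⟧') = 0 := hΔ.comp_zero₁₂ (hΔ.rotate _ (hΔ.rotate _ hT))
  simpa using h

/-- Rotate the contractible triangle on `X⟦-1⟧` twice; the resulting sign on the identity is
absorbed by `e' = -e`. -/
lemma contractible_left (X : D) : Triangle.mk (0 : 0 ⟶ X) (𝟙 X) 0 ∈ Δ := by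
  refine hΔ.of_iso _ (hΔ.rotate _ (hΔ.rotate _ (hΔ.contractible (X⟦(-1 : ℤ)⟧)))) _ ?_
  let e : X ≅ (X⟦(-1 : ℤ)⟧)⟦(1 : ℤ)⟧ := (shiftEquiv D (1 : ℤ)).counitIso.symm.app X
  have hz : IsZero ((0 : D)⟦(1 : ℤ)⟧) :=
    (shiftFunctor D (1 : ℤ)).map_isZero (isZero_zero D)
  let e' : X ≅ (X⟦(-1 : ℤ)⟧)⟦(1 : ℤ)⟧ := ⟨-e.hom, -e.inv, by simp, by simp⟩
  refine Triangle.isoMk _ _ (Iso.refl _) e e' ?_ ?_ ?_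
  · exact (isZero_zero D).eq_of_src _ _
  · change 𝟙 X ≫ (-e.hom) = e.hom ≫ (-(𝟙 (X⟦(-1 : ℤ)⟧))⟦(1 : ℤ)⟧')
    rw [Functor.map_id, Preadditive.comp_neg, Preadditive.comp_neg, Category.id_comp,
      Category.comp_id]
  · exact hz.eq_of_tgt _ _

/-- The factorization is the third component of a morphism from `T` to the triangle `0 ⟶ X ⟶ X`. -/
lemma exact₂ {T : Triangle D} (hT : T ∈ Δ) {X : D} (f : T.obj₂ ⟶ X) (hf : T.mor₁ ≫ f = 0) :
    ∃ g : T.obj₃ ⟶ X, f = T.mor₂ ≫ g := by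
  obtain ⟨g, hg, -⟩ := hΔ.complete _ _ hT (hΔ.contractible_left X) 0 f (hf.trans zero_comp.symm)
  exact ⟨g, (hg.trans (Category.comp_id f)).symm⟩

lemma exact₃ {T : Triangle D} (hT : T ∈ Δ) {X : D} (f : T.obj₃ ⟶ X) (hf : T.mor₂ ≫ f = 0) :
    ∃ g : T.obj₁⟦(1 : ℤ)⟧ ⟶ X, f = T.mor₃ ≫ g :=
  hΔ.exact₂ (hΔ.rotate _ hT) f hf

lemma exact₁ {T : Triangle D} (hT : T ∈ Δ) {X : D} (f : T.obj₁⟦(1 : ℤ)⟧ ⟶ X)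
    (hf : T.mor₃ ≫ f = 0) : ∃ g : T.obj₂⟦(1 : ℤ)⟧ ⟶ X, f = T.mor₁⟦1⟧' ≫ g := by
  obtain ⟨(g : T.obj₂⟦(1 : ℤ)⟧ ⟶ X), (hg : f = (-T.mor₁⟦1⟧') ≫ g)⟩ :=
    hΔ.exact₂ (hΔ.rotate _ (hΔ.rotate _ hT)) f hf
  exact ⟨-g, by rw [hg, Preadditive.neg_comp, Preadditive.comp_neg]⟩

/-- The five lemma for the contravariant functors `Hom(-, X)`: their exactness needs forward
rotations only, and injectivity and surjectivity for all `X` suffice. -/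
lemma isIso_hom₃ {T T' : Triangle D} (hT : T ∈ Δ) (hT' : T' ∈ Δ) (φ : T ⟶ T')
    (h₁ : IsIso φ.hom₁) (h₂ : IsIso φ.hom₂) : IsIso φ.hom₃ := by
  have hinj : ∀ {X : D} (u : T'.obj₃ ⟶ X), φ.hom₃ ≫ u = 0 → u = 0 := by
    intro X u hu
    obtain ⟨w, rfl⟩ := hΔ.exact₃ hT' u (by
      rw [← cancel_epi φ.hom₂, ← Category.assoc, ← φ.comm₂, Category.assoc, hu]
      simp)
    obtain ⟨w', hw'⟩ := hΔ.exact₁ hT (φ.hom₁⟦1⟧' ≫ w) (by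
      rw [← Category.assoc, φ.comm₃, Category.assoc, hu])
    have hw : w = T'.mor₁⟦1⟧' ≫ inv (φ.hom₂⟦1⟧') ≫ w' := by
      rw [← cancel_epi (φ.hom₁⟦1⟧'), hw', ← Category.assoc, ← Functor.map_comp, ← φ.comm₁,
        Functor.map_comp, Category.assoc, IsIso.hom_inv_id_assoc]
    rw [hw, ← Category.assoc, hΔ.comp_zero₃₁ hT', zero_comp]
  have hsurj : ∀ {X : D} (v : T.obj₃ ⟶ X), ∃ u, φ.hom₃ ≫ u = v := by
    intro X v
    obtain ⟨u, hu⟩ := hΔ.exact₂ hT' (inv φ.hom₂ ≫ T.mor₂ ≫ v) (by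
      rw [← cancel_epi φ.hom₁, ← Category.assoc, ← φ.comm₁, Category.assoc,
        IsIso.hom_inv_id_assoc, ← Category.assoc, hΔ.comp_zero₁₂ hT, zero_comp, comp_zero])
    obtain ⟨w, hw⟩ := hΔ.exact₃ hT (φ.hom₃ ≫ u - v) (by
      rw [Preadditive.comp_sub, ← Category.assoc, φ.comm₂, Category.assoc, ← hu,
        IsIso.hom_inv_id_assoc, sub_self])
    refine ⟨u - T'.mor₃ ≫ inv (φ.hom₁⟦1⟧') ≫ w, ?_⟩
    rw [Preadditive.comp_sub, ← reassoc_of% φ.comm₃, IsIso.hom_inv_id_assoc, ← hw, sub_sub_cancel]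
  obtain ⟨r, hr⟩ := hsurj (𝟙 _)
  refine ⟨r, hr, ?_⟩
  rw [← sub_eq_zero]
  apply hinj
  simp [reassoc_of% hr]

/-- Complete `T.mor₁` to a triangle of `Δ`. After three rotations both triangles lie in `Δ` and
begin with the same morphism, so they are isomorphic; rotation is fully faithful on all triangles,
so the isomorphism descends. -/
lemma of_rotate (T : Triangle D) (hT : T.rotate ∈ Δ) : T ∈ Δ := by
  obtain ⟨Z, g, h, hT'⟩ := hΔ.cocone T.mor₁
  have h₃ := hΔ.rotate _ (hΔ.rotate _ hT)
  have h₃' := hΔ.rotate _ (hΔ.rotate _ (hΔ.rotate _ hT'))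
  obtain ⟨c, hc₁, hc₂⟩ := hΔ.complete _ _ h₃ h₃' (𝟙 _) (𝟙 _)
    ((Category.comp_id _).trans (Category.id_comp _).symm)
  let φ : T.rotate.rotate.rotate ⟶ (Triangle.mk T.mor₁ g h).rotate.rotate.rotate :=
    { hom₁ := 𝟙 _
      hom₂ := 𝟙 _
      hom₃ := c
      comm₁ := (Category.comp_id _).trans (Category.id_comp _).symm
      comm₂ := hc₁
      comm₃ := hc₂ }
  have : IsIso φ := Triangle.isIso_of_isIsos _ (inferInstanceAs (IsIso (𝟙 _)))
    (inferInstanceAs (IsIso (𝟙 _))) (hΔ.isIso_hom₃ h₃ h₃' φ (inferInstanceAs (IsIso (𝟙 _)))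
    (inferInstanceAs (IsIso (𝟙 _))))
  let e₃ : T.rotate.rotate.rotate ≅ (Triangle.mk T.mor₁ g h).rotate.rotate.rotate := asIso φ
  let e : T ≅ Triangle.mk T.mor₁ g h := (Pretriangulated.rotate D ⋙ Pretriangulated.rotate D ⋙
    Pretriangulated.rotate D).preimageIso e₃
  exact hΔ.of_iso _ hT' _ e

/-- The pretriangulated structure. -/
@[reducible]
def pretriangulated : Pretriangulated D where
  distinguishedTriangles := Δ
  isomorphic_distinguished := hΔ.of_iso
  contractible_distinguished := hΔ.contractible
  distinguished_cocone_triangle := hΔ.cocone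
  rotate_distinguished_triangle T := ⟨hΔ.rotate T, hΔ.of_rotate T⟩
  complete_distinguished_triangle_morphism := hΔ.complete

end IsForwardPretriangulated

end ForwardRotation

end CategoryTheory

/-! ### Triangulated structures from classes of diagrams -/

section TriangulatedAxioms

open Pretriangulated

variable {D : Type*} [Category* D] [Preadditive D] {S : D ⥤ D}

/-- The axioms of a triangulated category in terms of a class of diagrams
`X ⟶ Y ⟶ Z ⟶ S X`. -/
structure TriangleClass.IsTriangulated (Δ : TriangleClass S) : Prop where
  of_iso : ∀ ⦃X Y Z : D⦄ (f : X ⟶ Y) (g : Y ⟶ Z) (h : Z ⟶ S.obj X), Δ.isoClosure f g h → Δ f g h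
  contractible : ∀ X : D, ∃ (Z : D) (_ : IsZero Z) (h : Z ⟶ S.obj X), Δ (𝟙 X) (0 : X ⟶ Z) h
  cocone : ∀ ⦃X Y : D⦄ (f : X ⟶ Y), ∃ (Z : D) (g : Y ⟶ Z) (h : Z ⟶ S.obj X), Δ f g h
  rotate : ∀ ⦃X Y Z : D⦄ (f : X ⟶ Y) (g : Y ⟶ Z) (h : Z ⟶ S.obj X), Δ f g h → Δ g h (-S.map f)
  complete : ∀ ⦃X Y Z X' Y' Z' : D⦄ (f : X ⟶ Y) (g : Y ⟶ Z) (h : Z ⟶ S.obj X)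
    (f' : X' ⟶ Y') (g' : Y' ⟶ Z') (h' : Z' ⟶ S.obj X') (_ : Δ f g h) (_ : Δ f' g' h')
    (a : X ⟶ X') (b : Y ⟶ Y') (_ : f ≫ b = a ≫ f'),
    ∃ c : Z ⟶ Z', g ≫ c = b ≫ g' ∧ h ≫ S.map a = c ≫ h'
  octahedron : ∀ ⦃X Y Z : D⦄ (f : X ⟶ Y) (g : Y ⟶ Z), ∃ (Z₁ Z₂ Z₃ : D)
    (f₁ : Y ⟶ Z₁) (h₁ : Z₁ ⟶ S.obj X) (f₂ : Z ⟶ Z₂) (h₂ : Z₂ ⟶ S.obj Y) (f₃ : Z ⟶ Z₃)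
    (h₃ : Z₃ ⟶ S.obj X) (m₁ : Z₁ ⟶ Z₃) (m₃ : Z₃ ⟶ Z₂), Δ f f₁ h₁ ∧ Δ g f₂ h₂ ∧
      Δ (f ≫ g) f₃ h₃ ∧ f₁ ≫ m₁ = g ≫ f₃ ∧ m₁ ≫ h₃ = h₁ ∧ f₃ ≫ m₃ = f₂ ∧
      h₃ ≫ S.map f = m₃ ≫ h₂ ∧ Δ m₁ m₃ (h₂ ≫ S.map f₁)

namespace TriangleClass.IsTriangulated

variable {Δ : TriangleClass S} (hΔ : Δ.IsTriangulated)
include hΔ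

lemma isForwardPretriangulated [HasZeroObject D] [HasShift D ℤ]
    [∀ n : ℤ, (shiftFunctor D n).Additive] (σ : shiftFunctor D (1 : ℤ) ≅ S) :
    IsForwardPretriangulated
      {T : Triangle D | Δ T.mor₁ T.mor₂ (T.mor₃ ≫ σ.hom.app T.obj₁)} where
  of_iso T₁ h T₂ e := hΔ.of_iso _ _ _ ⟨_, _, _, _, _, _, Triangle.π₁.mapIso e,
    Triangle.π₂.mapIso e, Triangle.π₃.mapIso e, h, e.hom.comm₁, e.hom.comm₂, by
      change (T₂.mor₃ ≫ σ.hom.app T₂.obj₁) ≫ S.map e.hom.hom₁ =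
        e.hom.hom₃ ≫ T₁.mor₃ ≫ σ.hom.app T₁.obj₁
      rw [Category.assoc, ← σ.hom.naturality, reassoc_of% e.hom.comm₃]⟩
  contractible X := by
    obtain ⟨Z, hZ, h, H⟩ := hΔ.contractible X
    exact hΔ.of_iso _ _ _ ⟨_, _, _, _, _, _, Iso.refl _, Iso.refl _, (isZero_zero D).iso hZ, H,
      (Category.comp_id (𝟙 X)).trans (Category.id_comp _).symm, hZ.eq_of_tgt _ _, (isZero_zero D).eq_of_src _ _⟩
  cocone f := by
    obtain ⟨Z, g, h, H⟩ := hΔ.cocone f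
    refine ⟨Z, g, h ≫ σ.inv.app _, ?_⟩
    change Δ f g ((h ≫ σ.inv.app _) ≫ σ.hom.app _)
    rwa [Category.assoc, Iso.inv_hom_id_app, Category.comp_id]
  rotate T hT := hΔ.of_iso _ _ _ ⟨_, _, _, _, _, _, Iso.refl _, Iso.refl _, σ.app T.obj₁,
    hΔ.rotate _ _ _ hT, (Category.comp_id T.mor₂).trans (Category.id_comp _).symm,
    (Category.id_comp (T.mor₃ ≫ σ.hom.app T.obj₁)).symm, by
      change ((-T.mor₁⟦1⟧') ≫ σ.hom.app T.obj₂) ≫ S.map (𝟙 T.obj₂) =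
        σ.hom.app T.obj₁ ≫ (-S.map T.mor₁)
      rw [CategoryTheory.Functor.map_id, Category.comp_id, Preadditive.neg_comp, σ.hom.naturality,
        Preadditive.comp_neg]⟩
  complete T₁ T₂ h₁ h₂ a b comm := by
    obtain ⟨c, hc, hc'⟩ := hΔ.complete _ _ _ _ _ _ h₁ h₂ a b comm
    refine ⟨c, hc, ?_⟩
    rw [← cancel_mono (σ.hom.app _), Category.assoc, σ.hom.naturality, ← Category.assoc, hc',
      Category.assoc]

/-- The shift by one is only isomorphic to `S`, so third morphisms are corrected by `σ`. By
`IsTriangulated.mk'`, one octahedron for each composable pair suffices. -/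
lemma nonempty_triangulatedStructure [HasZeroObject D] [S.IsEquivalence] [S.Additive] :
    Nonempty (TriangulatedStructure S Δ) := by
  obtain ⟨hs, ⟨σ⟩⟩ := exists_hasShift_of_isEquivalence S
  have : (shiftFunctor D (1 : ℤ)).Additive := Functor.additive_of_iso σ.symm
  have hadd (n : ℤ) : (shiftFunctor D n).Additive := additive_shiftFunctor_of_one n
  let hpre : Pretriangulated D := (hΔ.isForwardPretriangulated σ).pretriangulated
  refine ⟨⟨inferInstance, inferInstance, hs, hadd, hpre, ?_, σ, fun _ ↦ Iff.rfl⟩⟩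
  refine IsTriangulated.mk' fun X₁ X₂ X₃ u₁₂ u₂₃ ↦ ?_
  obtain ⟨Z₁, Z₂, Z₃, f₁, h₁, f₂, h₂, f₃, h₃, m₁, m₃, H₁, H₂, H₃, c₁, c₂, c₃, c₄, H⟩ :=
    hΔ.octahedron u₁₂ u₂₃
  have hmem {X Y Z : D} {f : X ⟶ Y} {g : Y ⟶ Z} {h : Z ⟶ S.obj X} (H : Δ f g h) :
      Triangle.mk f g (h ≫ σ.inv.app _) ∈ distTriang D := by
    change Δ f g ((h ≫ σ.inv.app X) ≫ σ.hom.app X)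
    simpa using H
  refine ⟨X₁, X₂, X₃, Z₁, Z₂, Z₃, u₁₂, u₂₃, Iso.refl _, Iso.refl _, Iso.refl _, by simp, by simp,
    f₁, _, hmem H₁, f₂, _, hmem H₂, f₃, _, hmem H₃, ⟨⟨m₁, m₃, c₁, ?_, c₃, ?_, ?_⟩⟩⟩
  · rw [← Category.assoc, c₂]
  · rw [Category.assoc, ← σ.inv.naturality, reassoc_of% c₄]
  · rw [Category.assoc, ← σ.inv.naturality, ← Category.assoc]
    exact hmem H

end TriangleClass.IsTriangulated

end TriangulatedAxioms

/-! ### Triangles up to isomorphism -/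

section IsoClosure

variable {D : Type*} [Category* D] {S : D ⥤ D} {P : TriangleClass S}

lemma TriangleClass.subset_isoClosure {X Y Z : D} {f : X ⟶ Y} {g : Y ⟶ Z} {h : Z ⟶ S.obj X}
    (H : P f g h) : P.isoClosure f g h :=
  ⟨_, _, _, _, _, _, Iso.refl _, Iso.refl _, Iso.refl _, H, by simp, by simp, by simp⟩

lemma TriangleClass.isoClosure_of_isoClosure {X Y Z : D} {f : X ⟶ Y} {g : Y ⟶ Z}
    {h : Z ⟶ S.obj X} (H : P.isoClosure.isoClosure f g h) : P.isoClosure f g h := by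
  obtain ⟨_, _, _, f', g', h', a, b, c, ⟨_, _, _, f'', g'', h'', a', b', c', H, h₁', h₂', h₃'⟩,
    h₁, h₂, h₃⟩ := H
  refine ⟨_, _, _, f'', g'', h'', a ≪≫ a', b ≪≫ b', c ≪≫ c', H, ?_, ?_, ?_⟩
  · simp [reassoc_of% h₁, h₁']
  · simp [reassoc_of% h₂, h₂']
  · simp [reassoc_of% h₃, h₃']

variable [Preadditive D]

/-- The axioms need only be checked on the given representatives; rotation and completion are
conjugated by the isomorphisms. -/
lemma TriangleClass.isTriangulated_isoClosure
    (contractible : ∀ X : D, ∃ (Z : D) (_ : IsZero Z) (h : Z ⟶ S.obj X),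
      P.isoClosure (𝟙 X) (0 : X ⟶ Z) h)
    (cocone : ∀ ⦃X Y : D⦄ (f : X ⟶ Y), ∃ (Z : D) (g : Y ⟶ Z) (h : Z ⟶ S.obj X), P f g h)
    (rotate : ∀ ⦃X Y Z : D⦄ (f : X ⟶ Y) (g : Y ⟶ Z) (h : Z ⟶ S.obj X), P f g h →
      P.isoClosure g h (-S.map f))
    (complete : ∀ ⦃X Y Z X' Y' Z' : D⦄ (f : X ⟶ Y) (g : Y ⟶ Z) (h : Z ⟶ S.obj X)
      (f' : X' ⟶ Y') (g' : Y' ⟶ Z') (h' : Z' ⟶ S.obj X') (_ : P f g h) (_ : P f' g' h')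
      (a : X ⟶ X') (b : Y ⟶ Y') (_ : f ≫ b = a ≫ f'),
      ∃ c : Z ⟶ Z', g ≫ c = b ≫ g' ∧ h ≫ S.map a = c ≫ h')
    (octahedron : ∀ ⦃X Y Z : D⦄ (f : X ⟶ Y) (g : Y ⟶ Z), ∃ (Z₁ Z₂ Z₃ : D)
      (f₁ : Y ⟶ Z₁) (h₁ : Z₁ ⟶ S.obj X) (f₂ : Z ⟶ Z₂) (h₂ : Z₂ ⟶ S.obj Y) (f₃ : Z ⟶ Z₃)
      (h₃ : Z₃ ⟶ S.obj X) (m₁ : Z₁ ⟶ Z₃) (m₃ : Z₃ ⟶ Z₂), P f f₁ h₁ ∧ P g f₂ h₂ ∧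
        P (f ≫ g) f₃ h₃ ∧ f₁ ≫ m₁ = g ≫ f₃ ∧ m₁ ≫ h₃ = h₁ ∧ f₃ ≫ m₃ = f₂ ∧
        h₃ ≫ S.map f = m₃ ≫ h₂ ∧ P.isoClosure m₁ m₃ (h₂ ≫ S.map f₁)) :
    P.isoClosure.IsTriangulated where
  of_iso _ _ _ _ _ _ := isoClosure_of_isoClosure
  contractible := contractible
  cocone _ _ f := by
    obtain ⟨Z, g, h, H⟩ := cocone f
    exact ⟨Z, g, h, subset_isoClosure H⟩
  rotate := by
    rintro X Y Z f g h ⟨_, _, _, f', g', h', a, b, c, H, h₁, h₂, h₃⟩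
    exact isoClosure_of_isoClosure ⟨_, _, _, _, _, _, b, c, S.mapIso a, rotate _ _ _ H, h₂, h₃, by
      simp [← Functor.map_comp, h₁]⟩
  complete := by
    rintro X Y Z X' Y' Z' f g h f' g' h' ⟨_, _, _, f₁, g₁, h₁, a₁, b₁, c₁, H₁, e₁, e₂, e₃⟩
      ⟨_, _, _, f₂, g₂, h₂, a₂, b₂, c₂, H₂, e₁', e₂', e₃'⟩ a b hab
    obtain ⟨c, hc, hc'⟩ := complete _ _ _ _ _ _ H₁ H₂ (a₁.inv ≫ a ≫ a₂.hom)
      (b₁.inv ≫ b ≫ b₂.hom) (by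
        rw [← cancel_epi a₁.hom, ← reassoc_of% e₁]
        simp [reassoc_of% hab, e₁'])
    refine ⟨c₁.hom ≫ c ≫ c₂.inv, ?_, ?_⟩
    · rw [reassoc_of% e₂, reassoc_of% hc]
      simp [← reassoc_of% e₂']
    · have : S.map a = S.map a₁.hom ≫ S.map (a₁.inv ≫ a ≫ a₂.hom) ≫ S.map a₂.inv := by
        simp [← Functor.map_comp]
      rw [this, reassoc_of% e₃, reassoc_of% hc']
      have e₃'' : h₂ ≫ S.map a₂.inv = c₂.inv ≫ h' := by
        rw [Iso.eq_inv_comp, ← reassoc_of% e₃', ← Functor.map_comp, Iso.hom_inv_id,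
          CategoryTheory.Functor.map_id, Category.comp_id]
      simp [e₃'']
  octahedron X Y Z f g := by
    obtain ⟨Z₁, Z₂, Z₃, f₁, h₁, f₂, h₂, f₃, h₃, m₁, m₃, H₁, H₂, H₃, H⟩ := octahedron f g
    exact ⟨Z₁, Z₂, Z₃, f₁, h₁, f₂, h₂, f₃, h₃, m₁, m₃, subset_isoClosure H₁,
      subset_isoClosure H₂, subset_isoClosure H₃, H⟩

end IsoClosure

namespace ExactStructure

variable {C : Type u} [Category.{v} C] [Preadditive C] {E : ExactStructure C} [E.IsFrobenius]

/-! ### The suspension is an autoequivalence -/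

section Suspension

lemma isProjective_inj (X : C) : E.IsProjective (E.inj X) := (E.hull X).injective.isProjective

lemma inflations_ι (X : C) : E.inflations (E.ι X) := ⟨_, _, _, (E.hull X).conflation⟩

lemma deflations_π (X : C) : E.deflations (E.π X) := ⟨_, _, _, (E.hull X).conflation⟩

lemma exists_ι_lift {X Y : C} (g : Y ⟶ E.inj X) (hg : g ≫ E.π X = 0) :
    ∃ h : Y ⟶ X, h ≫ E.ι X = g :=
  conflation_lift (E.hull X).conflation g hg

lemma exists_inj_desc {X Y I : C} {i : X ⟶ Y} (hi : E.inflations i) (hI : E.IsProjective I)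
    (f : X ⟶ I) : ∃ g : Y ⟶ I, i ≫ g = f :=
  hI.isInjective i hi f

lemma suspension_map_toStable_map {X Y : C} {f : X ⟶ Y} {h : E.susp X ⟶ E.susp Y}
    (H : E.IsSuspMap f h) : E.suspension.map (E.toStable.map f) = E.toStable.map h :=
  (E.suspMap_spec f).eq H

lemma IsSuspMap.add {X Y : C} {f f' : X ⟶ Y} {h h' : E.susp X ⟶ E.susp Y}
    (H : E.IsSuspMap f h) (H' : E.IsSuspMap f' h') : E.IsSuspMap (f + f') (h + h') := by
  obtain ⟨g, hg, hg'⟩ := H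
  obtain ⟨k, hk, hk'⟩ := H'
  exact ⟨g + k, by simp [hg, hk], by simp [hg', hk']⟩

variable [HasBinaryBiproducts C] [HasZeroObject C]

instance : E.suspension.Additive where
  map_add {X Y f g} := by
    obtain ⟨f, rfl⟩ := E.toStable.map_surjective (X := X.as) (Y := Y.as) f
    obtain ⟨g, rfl⟩ := E.toStable.map_surjective (X := X.as) (Y := Y.as) g
    rw [← Functor.map_add, suspension_map_toStable_map ((E.suspMap_spec f).add (E.suspMap_spec g)),
      Functor.map_add]
    rfl

/-- A map `ΣX ⟶ ΣY` lifts to the hulls because `I(X)` is projective, and the lift restricts to the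
kernels. -/
instance : E.suspension.Full where
  map_surjective {X Y} h := by
    obtain ⟨h, rfl⟩ := E.toStable.map_surjective (X := E.susp X.as) (Y := E.susp Y.as) h
    obtain ⟨g, hg⟩ := isProjective_inj X.as (E.π Y.as) (deflations_π _) (E.π X.as ≫ h)
    obtain ⟨f, hf⟩ := exists_ι_lift (E.ι X.as ≫ g) (by
      rw [Category.assoc, hg, ← Category.assoc, E.ι_π, zero_comp])
    exact ⟨E.toStable.map f, suspension_map_toStable_map ⟨g, hf.symm, hg.symm⟩⟩

/-- If `Σf` factors through a projective, the factorization lifts through `E.π Y`. Subtracting it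
from the extension `g` leaves a map landing in `Y`, so `f` factors through `I(X)`. -/
instance : E.suspension.Faithful := by
  have key {X Y : C} (f : X ⟶ Y) (hf : E.suspension.map (E.toStable.map f) = 0) :
      E.toStable.map f = 0 := by
    obtain ⟨g, hg, hg'⟩ := E.suspMap_spec f
    have hf' : E.toStable.map (E.suspMap f) = E.toStable.map 0 := by
      rw [Functor.map_zero]
      exact hf
    obtain ⟨P, s, t, hP, hst⟩ := (toStable_map_eq_iff _ _).1 hf'
    obtain ⟨t', rfl⟩ := hP (E.π Y) (deflations_π _) t
    obtain ⟨l, hl⟩ := exists_ι_lift (g - E.π X ≫ s ≫ t') (by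
      rw [sub_zero] at hst
      simp [← hg', hst])
    have := inflation_mono (inflations_ι (E := E) Y)
    rw [← E.toStable.map_zero]
    refine toStable_map_eq (E.ι X) l (isProjective_inj X) ?_
    rw [← cancel_mono (E.ι Y), Category.assoc, hl]
    simp [hg, reassoc_of% E.ι_π]
  refine ⟨fun {X Y f g} h ↦ ?_⟩
  obtain ⟨k, hk⟩ := E.toStable.map_surjective (X := X.as) (Y := Y.as) (f - g)
  rw [← sub_eq_zero, ← hk]
  refine key k ?_
  rw [hk, Functor.map_sub, h, sub_self]

/-- Cokernels of inclusions of an object into injective objects are stably isomorphic. -/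
lemma nonempty_toStable_susp_iso {X I Z : C} {i : X ⟶ I} {p : I ⟶ Z} {w : i ≫ p = 0}
    (h : E.conflation (ShortComplex.mk i p w)) (hI : E.IsProjective I) :
    Nonempty (E.toStable.obj (E.susp X) ≅ E.toStable.obj Z) := by
  have aux {I I' Z Z' : C} {i : X ⟶ I} {p : I ⟶ Z} {w : i ≫ p = 0} {i' : X ⟶ I'}
      {p' : I' ⟶ Z'} (h : E.conflation (ShortComplex.mk i p w))
      (hI : E.IsProjective I) (c : I ⟶ I') (d : I' ⟶ I) (hc : i ≫ c = i') (hd : i' ≫ d = i)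
      (c' : Z ⟶ Z') (d' : Z' ⟶ Z) (hc' : p ≫ c' = c ≫ p') (hd' : p' ≫ d' = d ≫ p) :
      E.toStable.map c' ≫ E.toStable.map d' = 𝟙 _ := by
    -- `c ≫ d` and `𝟙` agree on `X`, so their difference is `p ≫ t`; on cokernels the difference
    -- becomes `t ≫ p`, which factors through `I`.
    obtain ⟨t, ht⟩ := conflation_desc h (c ≫ d - 𝟙 _) (by simp [reassoc_of% hc, hd])
    have := conflation_epi h
    rw [← Functor.map_comp, ← E.toStable.map_id]
    refine toStable_map_eq t p hI ?_
    rw [← cancel_epi p, reassoc_of% ht]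
    simp [reassoc_of% hc', hd']
  obtain ⟨c, hc⟩ := exists_inj_desc (inflations_ι (E := E) X) hI i
  obtain ⟨d, hd⟩ := exists_inj_desc (E := E) ⟨_, _, _, h⟩ (isProjective_inj X) (E.ι X)
  obtain ⟨c', hc'⟩ := E.π_desc (c ≫ p) (by rw [reassoc_of% hc, w])
  obtain ⟨d', hd'⟩ := conflation_desc h (d ≫ E.π X) (by rw [reassoc_of% hd, E.ι_π])
  exact ⟨⟨E.toStable.map c', E.toStable.map d',
    aux (E.hull X).conflation (isProjective_inj X) c d hc hd c' d' hc' hd',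
    aux h hI d c hd hc d' c' hd' hc'⟩⟩

/-- A projective presentation `K ⟶ P ⟶ X` is also an injective copresentation of `K`, so `X` is
stably `ΣK`. -/
instance : E.suspension.EssSurj where
  mem_essImage X := by
    obtain ⟨P, p, hP, K, i, w, h⟩ := IsFrobenius.enough_projectives (E := E) X.as
    exact ⟨E.toStable.obj K, nonempty_toStable_susp_iso h hP⟩

instance : E.suspension.IsEquivalence where

end Suspension

/-! ### Standard triangles -/

section Cone

/-- A mapping cone of a morphism: a pushout of the inclusion into the injective hull, together with
the projection to the suspension. -/
structure Cone (E : ExactStructure C) [E.IsFrobenius] {X Y : C} (f : X ⟶ Y) where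
  W : C
  g : Y ⟶ W
  j : E.inj X ⟶ W
  d : W ⟶ E.susp X
  sq : IsPushout f (E.ι X) g j
  hg : g ≫ d = 0
  hj : j ≫ d = E.π X

lemma nonempty_cone {X Y : C} (f : X ⟶ Y) : Nonempty (E.Cone f) := by
  obtain ⟨W, j, g, sq, -⟩ := E.exists_pushout (E.ι X) f (inflations_ι X)
  exact ⟨⟨W, g, j, sq.flip.desc 0 (E.π X) (by rw [comp_zero, E.ι_π]), sq.flip, by simp, by simp⟩⟩

namespace Cone

variable {X Y : C} {f : X ⟶ Y} (c : E.Cone f)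

lemma isStandardTriangle :
    E.IsStandardTriangle (E.toStable.map f) (E.toStable.map c.g) (E.toStable.map c.d) :=
  ⟨f, c.g, c.j, c.d, c.sq, c.hg, c.hj⟩

lemma w : f ≫ c.g = E.ι X ≫ c.j := c.sq.w

lemma w_assoc {T : C} (k : c.W ⟶ T) : f ≫ c.g ≫ k = E.ι X ≫ c.j ≫ k := by
  rw [← Category.assoc, c.w, Category.assoc]

lemma hg_assoc {T : C} (k : E.susp X ⟶ T) : c.g ≫ c.d ≫ k = 0 ≫ k := by
  rw [← Category.assoc, c.hg]

lemma hj_assoc {T : C} (k : E.susp X ⟶ T) : c.j ≫ c.d ≫ k = E.π X ≫ k := by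
  rw [← Category.assoc, c.hj]

lemma inflations_g : E.inflations c.g := inflation_of_isPushout c.sq.flip (inflations_ι X)

lemma exists_desc {T : C} (a : Y ⟶ T) (b : E.inj X ⟶ T) (h : f ≫ a = E.ι X ≫ b) :
    ∃ l : c.W ⟶ T, c.g ≫ l = a ∧ c.j ≫ l = b :=
  ⟨c.sq.desc a b h, c.sq.inl_desc _ _ _, c.sq.inr_desc _ _ _⟩

lemma hom_ext {T : C} {l l' : c.W ⟶ T} (h₁ : c.g ≫ l = c.g ≫ l') (h₂ : c.j ≫ l = c.j ≫ l') :
    l = l' :=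
  c.sq.hom_ext h₁ h₂

/-- A homotopy criterion: as `a` vanishes on `X`, it extends by zero on `Y` to the cone, and `l -
l'` factors through `P`. -/
lemma toStable_map_eq [HasBinaryBiproducts C] [HasZeroObject C] {T : C} {l l' : c.W ⟶ T}
    (h₁ : c.g ≫ l = c.g ≫ l') {P : C} (hP : E.IsProjective P) (a : E.inj X ⟶ P) (b : P ⟶ T)
    (ha : E.ι X ≫ a = 0) (h₂ : c.j ≫ l - c.j ≫ l' = a ≫ b) :
    E.toStable.map l = E.toStable.map l' := by
  obtain ⟨k, hk, hk'⟩ := c.exists_desc 0 a (by rw [ha, comp_zero])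
  refine ExactStructure.toStable_map_eq k b hP (c.hom_ext ?_ ?_)
  · simp [h₁, reassoc_of% hk]
  · simp [h₂, reassoc_of% hk']

lemma exists_map [HasBinaryBiproducts C] [HasZeroObject C] {X' Y' : C} {f' : X' ⟶ Y'}
    (c' : E.Cone f') (a : X ⟶ X') (b : Y ⟶ Y') (h : E.stableRel (f ≫ b) (a ≫ f')) :
    ∃ φ : c.W ⟶ c'.W, c.g ≫ φ = b ≫ c'.g ∧ c.d ≫ E.suspMap a = φ ≫ c'.d := by
  obtain ⟨P, s, t, hP, hst⟩ := h
  obtain ⟨s', rfl⟩ := exists_inj_desc (inflations_ι (E := E) X) hP s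
  obtain ⟨k, hk, hk'⟩ := E.suspMap_spec a
  -- The square fails to commute by `E.ι X ≫ s' ≫ t`. The second summand corrects this, and since
  -- `c'.d` kills it, the last square commutes strictly.
  obtain ⟨φ, h₁, h₂⟩ := c.exists_desc (b ≫ c'.g) (k ≫ c'.j + s' ≫ t ≫ c'.g) (by
    rw [← sub_eq_zero, Preadditive.comp_add, reassoc_of% hk, ← c'.w]
    have := hst =≫ c'.g
    simp only [Preadditive.sub_comp, Category.assoc] at this
    rw [← this]
    abel)
  refine ⟨φ, h₁, c.hom_ext ?_ ?_⟩
  · rw [c.hg_assoc, zero_comp, reassoc_of% h₁, c'.hg, comp_zero]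
  · rw [c.hj_assoc, hk', reassoc_of% h₂]
    simp [c'.hg, c'.hj]

lemma isoClosure_rotate [HasBinaryBiproducts C] [HasZeroObject C] :
    E.distTriangles (E.toStable.map c.g) (E.toStable.map c.d)
      (-E.suspension.map (E.toStable.map f)) := by
  obtain ⟨c'⟩ := nonempty_cone (E := E) c.g
  obtain ⟨k, hk, hk'⟩ := E.suspMap_spec f
  obtain ⟨θ, hθ, hθ'⟩ := c'.exists_desc c.d 0 (by rw [c.hg, comp_zero])
  -- The maps from `I(X)` to the cone of `c.g` through `c.W` and through `I(Y)` agree on `X`. Their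
  -- difference descends to `ΣX`, and its second term produces the sign in `-Σf`.
  obtain ⟨ρ, hρ⟩ := E.π_desc (c.j ≫ c'.g - k ≫ c'.j) (by
    rw [Preadditive.comp_sub, reassoc_of% hk, ← c'.w, c.w_assoc, sub_self])
  have hρθ : ρ ≫ θ = 𝟙 _ := E.π_cancel (by
    rw [reassoc_of% hρ]
    simp [hθ, hθ', c.hj])
  have hρd : ρ ≫ c'.d = -E.suspMap f := E.π_cancel (by
    rw [reassoc_of% hρ]
    simp [c'.hg, c'.hj, hk'])
  have hθρ : E.toStable.map (θ ≫ ρ) = E.toStable.map (𝟙 _) := by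
    -- `n` will retract the cone of `c.g` onto `I(Y)`, with `𝟙 - θ ≫ ρ = n ≫ c'.j`.
    obtain ⟨m, hm, hm'⟩ := c.exists_desc (E.ι Y) k hk.symm
    obtain ⟨n, hn, hn'⟩ := c'.exists_desc m (𝟙 _) (by rw [hm, Category.comp_id])
    refine (ExactStructure.toStable_map_eq n c'.j (isProjective_inj Y) (c'.hom_ext ?_ ?_)).symm
    · refine c.hom_ext ?_ ?_
      · simp [reassoc_of% hθ, reassoc_of% hn, reassoc_of% hm, c.hg_assoc, c'.w]
      · simp [reassoc_of% hθ, reassoc_of% hn, reassoc_of% hm', c.hj_assoc, hρ]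
    · simp [reassoc_of% hθ', reassoc_of% hn']
  refine ⟨_, _, _, _, _, _, Iso.refl _, Iso.refl _,
    ⟨E.toStable.map ρ, E.toStable.map θ, ?_, ?_⟩, c'.isStandardTriangle, ?_, ?_, ?_⟩
  · rw [← CategoryTheory.Functor.map_comp, hρθ, CategoryTheory.Functor.map_id]
  · rw [← CategoryTheory.Functor.map_comp, hθρ, CategoryTheory.Functor.map_id]
  · simp
  · change _ ≫ E.toStable.map ρ = 𝟙 _ ≫ _
    rw [← hθ, CategoryTheory.Functor.map_comp, Category.assoc, ← E.toStable.map_comp θ, hθρ, CategoryTheory.Functor.map_id]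
    simp
  · change _ ≫ E.suspension.map (𝟙 _) = E.toStable.map ρ ≫ E.toStable.map c'.d
    rw [← CategoryTheory.Functor.map_comp, hρd, CategoryTheory.Functor.map_id, Functor.map_neg]
    exact Category.comp_id (-E.suspension.map (E.toStable.map f))

end Cone

end Cone

end ExactStructure

/-! ### The octahedral axiom and the triangulation of the stable category -/

namespace ExactStructure

variable {C : Type u} [Category.{v} C] [Preadditive C] {E : ExactStructure C} [E.IsFrobenius]
  [HasBinaryBiproducts C] [HasZeroObject C]

namespace Cone

/-- The last triangle amounts to a stable isomorphism `ρ` from the cone of `g` to the cone of `m₁`.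
These objects are glued from the hulls `I(Y)` and `I(Cone f)`, which `e` and `e'` compare relative
to `Y`. -/
lemma exists_octahedron {X Y Z : C} {f : X ⟶ Y} {g : Y ⟶ Z} (cf : E.Cone f) (cg : E.Cone g)
    (cfg : E.Cone (f ≫ g)) : ∃ (m₁ : cf.W ⟶ cfg.W) (m₃ : cfg.W ⟶ cg.W), cf.g ≫ m₁ = g ≫ cfg.g ∧
      m₁ ≫ cfg.d = cf.d ∧ cfg.g ≫ m₃ = cg.g ∧ cfg.d ≫ E.suspMap f = m₃ ≫ cg.d ∧
      E.distTriangles (E.toStable.map m₁) (E.toStable.map m₃)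
        (E.toStable.map cg.d ≫ E.suspension.map (E.toStable.map cf.g)) := by
  obtain ⟨m₁, hm₁, hm₁'⟩ := cf.exists_desc (g ≫ cfg.g) cfg.j (by rw [← cfg.w, Category.assoc])
  obtain ⟨k, hk, hk'⟩ := E.suspMap_spec f
  obtain ⟨m₃, hm₃, hm₃'⟩ := cfg.exists_desc cg.g (k ≫ cg.j) (by
    rw [reassoc_of% hk, Category.assoc, cg.w])
  obtain ⟨c⟩ := nonempty_cone (E := E) m₁
  obtain ⟨e, he, he'⟩ := E.suspMap_spec cf.g
  obtain ⟨e', h_e'⟩ := exists_inj_desc (E.inflation_comp _ _ cf.inflations_g (inflations_ι cf.W))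
    (isProjective_inj Y) (E.ι Y)
  rw [Category.assoc] at h_e'
  obtain ⟨ρ, hρ, hρ'⟩ := cg.exists_desc (cfg.g ≫ c.g) (e ≫ c.j) (by
    rw [reassoc_of% he, ← c.w, reassoc_of% hm₁])
  -- `κ` agrees with `m₃` on `Z`, but on `I(X)` it passes through `I(Cone f)`, so that it glues
  -- strictly with `e' ≫ cg.j`.
  obtain ⟨κ, hκ, hκ'⟩ := cfg.exists_desc cg.g (cf.j ≫ E.ι _ ≫ e' ≫ cg.j) (by
    rw [← cf.w_assoc, reassoc_of% h_e', Category.assoc, cg.w])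
  obtain ⟨θ, hθ, hθ'⟩ := c.exists_desc κ (e' ≫ cg.j) (cf.hom_ext
    (by rw [reassoc_of% hm₁, hκ, cg.w, reassoc_of% h_e']) (by rw [reassoc_of% hm₁', hκ']))
  -- `n` will be the homotopy from `θ ≫ ρ` to the identity: zero on `Z` and `e' ≫ e - 𝟙` on the hull
  -- of `cf.W`.
  obtain ⟨l, hl, hl'⟩ := cfg.exists_desc 0 (cf.j ≫ E.ι _ ≫ (e' ≫ e - 𝟙 _)) (by
    rw [← cf.w_assoc]
    simp [reassoc_of% h_e', he])
  obtain ⟨n, hn, hn'⟩ := c.exists_desc l (e' ≫ e - 𝟙 _) (cf.hom_ext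
    (by rw [reassoc_of% hm₁, hl]; simp [reassoc_of% h_e', he])
    (by rw [reassoc_of% hm₁', hl']))
  have hρθ : E.toStable.map (ρ ≫ θ) = E.toStable.map (𝟙 _) :=
    cg.toStable_map_eq (by simp [reassoc_of% hρ, hθ, hκ]) (isProjective_inj Y) (e ≫ e' - 𝟙 _) cg.j
      (by simp [reassoc_of% he, h_e']) (by simp [reassoc_of% hρ', hθ'])
  have hθρ : E.toStable.map (θ ≫ ρ) = E.toStable.map (𝟙 _) := by
    refine ExactStructure.toStable_map_eq n c.j (isProjective_inj cf.W) (c.hom_ext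
      (cfg.hom_ext ?_ ?_) ?_)
    · simp [reassoc_of% hn, reassoc_of% hl, reassoc_of% hθ, reassoc_of% hκ, hρ]
    · have : cf.j ≫ E.ι cf.W ≫ c.j = cfg.j ≫ c.g := by rw [← c.w, reassoc_of% hm₁']
      simp [reassoc_of% hn, reassoc_of% hl', reassoc_of% hθ, reassoc_of% hκ', hρ', this]
    · simp [reassoc_of% hn', reassoc_of% hθ', hρ']
  -- Both maps agree on `Z`; on `I(X)` they come from `k ≫ e` and `cf.j ≫ E.ι _`, two extensions of
  -- the same map from `X` to `I(Cone f)`.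
  have hm₃ρ : E.toStable.map (m₃ ≫ ρ) = E.toStable.map c.g := by
    refine cfg.toStable_map_eq (by rw [reassoc_of% hm₃, hρ]) (isProjective_inj cf.W)
      (k ≫ e - cf.j ≫ E.ι _) c.j ?_ ?_
    · simp [reassoc_of% hk, he, ← cf.w_assoc]
    · have : cfg.j ≫ c.g = cf.j ≫ E.ι cf.W ≫ c.j := by rw [← c.w, reassoc_of% hm₁']
      simp [reassoc_of% hm₃', hρ', this]
  have hρd : ρ ≫ c.d = cg.d ≫ E.suspMap cf.g := by
    refine cg.hom_ext ?_ ?_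
    · rw [reassoc_of% hρ, c.hg, cg.hg_assoc, zero_comp, comp_zero]
    · rw [reassoc_of% hρ', c.hj, cg.hj_assoc, he']
  refine ⟨m₁, m₃, hm₁, ?_, hm₃, ?_, ?_⟩
  · refine cf.hom_ext ?_ ?_
    · rw [reassoc_of% hm₁, cfg.hg, cf.hg, comp_zero]
    · rw [reassoc_of% hm₁', cfg.hj, cf.hj]
  · refine cfg.hom_ext ?_ ?_
    · rw [cfg.hg_assoc, zero_comp, reassoc_of% hm₃, cg.hg]
    · rw [cfg.hj_assoc, reassoc_of% hm₃', hk', cg.hj]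
  · refine ⟨_, _, _, _, _, _, Iso.refl _, Iso.refl _,
      ⟨E.toStable.map ρ, E.toStable.map θ, ?_, ?_⟩, c.isStandardTriangle, ?_, ?_, ?_⟩
    · rw [← CategoryTheory.Functor.map_comp, hρθ, CategoryTheory.Functor.map_id]
    · rw [← CategoryTheory.Functor.map_comp, hθρ, CategoryTheory.Functor.map_id]
    · simp
    · change E.toStable.map m₃ ≫ E.toStable.map ρ = 𝟙 _ ≫ _
      rw [← CategoryTheory.Functor.map_comp, hm₃ρ, Category.id_comp]
    · have : E.suspension.map (E.toStable.map cf.g) = E.toStable.map (E.suspMap cf.g) := rfl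
      change (E.toStable.map cg.d ≫ E.suspension.map (E.toStable.map cf.g)) ≫
        E.suspension.map (𝟙 _) = E.toStable.map ρ ≫ E.toStable.map c.d
      rw [← CategoryTheory.Functor.map_comp, hρd, CategoryTheory.Functor.map_id,
        CategoryTheory.Functor.map_comp]
      exact Category.comp_id _

end Cone

/-- `I(X)` is itself a mapping cone of the identity, and it is stably zero. -/
lemma exists_contractible (X : C) : ∃ (Z : E.Stable) (_ : IsZero Z)
    (h : Z ⟶ E.suspension.obj (E.toStable.obj X)),
    E.distTriangles (𝟙 (E.toStable.obj X)) (0 : E.toStable.obj X ⟶ Z) h := by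
  have hZ := isZero_toStable_obj (isProjective_inj (E := E) X)
  refine ⟨_, hZ, E.toStable.map (E.π X), ?_⟩
  have := IsStandardTriangle.mk (E := E) (𝟙 X) (E.ι X) (𝟙 _) (E.π X)
    (IsPushout.of_horiz_isIso ⟨by simp⟩) (E.ι_π X) (by simp)
  rw [CategoryTheory.Functor.map_id, hZ.eq_of_tgt (E.toStable.map (E.ι X)) 0] at this
  exact TriangleClass.subset_isoClosure this

lemma isTriangulated_distTriangles : E.distTriangles.IsTriangulated :=
  TriangleClass.isTriangulated_isoClosure (fun X ↦ exists_contractible X.as)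
    (fun X Y f ↦ by
      obtain ⟨f, rfl⟩ := E.toStable.map_surjective (X := X.as) (Y := Y.as) f
      obtain ⟨c⟩ := nonempty_cone (E := E) f
      exact ⟨_, _, _, c.isStandardTriangle⟩)
    (by
      rintro _ _ _ _ _ _ ⟨f, g, j, d, sq, hg, hj⟩
      exact (Cone.mk _ g j d sq hg hj).isoClosure_rotate)
    (by
      rintro _ _ _ _ _ _ _ _ _ _ _ _ ⟨f, g, j, d, sq, hg, hj⟩ ⟨f', g', j', d', sq', hg', hj'⟩ a b h
      obtain ⟨a, rfl⟩ := E.toStable.map_surjective a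
      obtain ⟨b, rfl⟩ := E.toStable.map_surjective b
      rw [← CategoryTheory.Functor.map_comp, ← CategoryTheory.Functor.map_comp,
        toStable_map_eq_iff] at h
      obtain ⟨φ, h₁, h₂⟩ := (Cone.mk _ g j d sq hg hj).exists_map
        (Cone.mk _ g' j' d' sq' hg' hj') a b h
      refine ⟨E.toStable.map φ, ?_, ?_⟩
      · rw [← CategoryTheory.Functor.map_comp, h₁, CategoryTheory.Functor.map_comp]
      · change E.toStable.map d ≫ E.toStable.map (E.suspMap a) = _
        rw [← CategoryTheory.Functor.map_comp, h₂, CategoryTheory.Functor.map_comp]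
        rfl)
    (fun X Y Z f g ↦ by
      obtain ⟨f, rfl⟩ := E.toStable.map_surjective (X := X.as) (Y := Y.as) f
      obtain ⟨g, rfl⟩ := E.toStable.map_surjective (X := Y.as) (Y := Z.as) g
      obtain ⟨cf⟩ := nonempty_cone (E := E) f
      obtain ⟨cg⟩ := nonempty_cone (E := E) g
      obtain ⟨cfg⟩ := nonempty_cone (E := E) (f ≫ g)
      obtain ⟨m₁, m₃, h₁, h₂, h₃, h₄, h₅⟩ := Cone.exists_octahedron cf cg cfg
      refine ⟨E.toStable.obj cf.W, E.toStable.obj cg.W, E.toStable.obj cfg.W,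
        E.toStable.map cf.g, E.toStable.map cf.d, E.toStable.map cg.g, E.toStable.map cg.d,
        E.toStable.map cfg.g, E.toStable.map cfg.d, E.toStable.map m₁, E.toStable.map m₃,
        cf.isStandardTriangle, cg.isStandardTriangle, ?_, ?_, ?_, ?_, ?_, h₅⟩
      · rw [← CategoryTheory.Functor.map_comp]
        exact cfg.isStandardTriangle
      · rw [← CategoryTheory.Functor.map_comp, h₁, CategoryTheory.Functor.map_comp]
      · exact (E.toStable.map_comp _ _).symm.trans (congrArg E.toStable.map h₂)
      · rw [← CategoryTheory.Functor.map_comp, h₃]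
      · change E.toStable.map cfg.d ≫ E.toStable.map (E.suspMap f) = _
        rw [← CategoryTheory.Functor.map_comp, h₄, CategoryTheory.Functor.map_comp]
        rfl)

variable (E) in
lemma nonempty_triangulatedStructure_stable :
    Nonempty (TriangulatedStructure E.suspension E.distTriangles) :=
  isTriangulated_distTriangles.nonempty_triangulatedStructure

end ExactStructure

/-! ### Transport of triangulated structures along equivalences -/

section Transport

open Pretriangulated ZeroObject

variable {D D' : Type*} [Category* D] [Category* D']

/-- The pretriangulated structure on the source of an equivalence `G` of categories with shift
for which a triangle is distinguished if and only if its image by `G` is. -/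
@[reducible]
def CategoryTheory.Pretriangulated.ofIsEquivalence [HasShift D ℤ] [HasShift D' ℤ] [Preadditive D]
    [Preadditive D'] [HasZeroObject D] [HasZeroObject D'] [∀ n : ℤ, (shiftFunctor D n).Additive]
    [∀ n : ℤ, (shiftFunctor D' n).Additive] [Pretriangulated D] (G : D' ⥤ D) [G.CommShift ℤ]
    [G.Additive] [G.IsEquivalence] : Pretriangulated D' where
  distinguishedTriangles := G.mapTriangle.obj ⁻¹' (distTriang D)
  isomorphic_distinguished T₁ hT₁ T₂ e :=
    isomorphic_distinguished _ hT₁ _ (G.mapTriangle.mapIso e)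
  contractible_distinguished X :=
    isomorphic_distinguished _ (contractible_distinguished (G.obj X)) _
      (Triangle.isoMk _ _ (Iso.refl _) (Iso.refl _) G.mapZeroObject
        ((Category.comp_id (G.map (𝟙 X))).trans
          ((G.map_id X).trans (Category.id_comp (𝟙 (G.obj X))).symm)) ((isZero_zero D).eq_of_tgt _ _)
        ((G.map_isZero (isZero_zero D')).eq_of_src _ _))
  distinguished_cocone_triangle {X Y} f := by
    obtain ⟨Z', g', h', mem⟩ := distinguished_cocone_triangle (G.map f)
    let e := G.objObjPreimageIso Z'
    refine ⟨G.objPreimage Z', G.preimage (g' ≫ e.inv),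
      G.preimage (e.hom ≫ h' ≫ (G.commShiftIso (1 : ℤ)).inv.app X),
      isomorphic_distinguished _ mem _ (Triangle.isoMk _ _ (Iso.refl _) (Iso.refl _) e ?_ ?_ ?_)⟩
    · exact (Category.comp_id _).trans (Category.id_comp _).symm
    · change G.map (G.preimage (g' ≫ e.inv)) ≫ e.hom = 𝟙 _ ≫ g'
      simp
    · change (G.map (G.preimage (e.hom ≫ h' ≫ (G.commShiftIso (1 : ℤ)).inv.app X)) ≫
        (G.commShiftIso (1 : ℤ)).hom.app X) ≫ (𝟙 (G.obj X))⟦(1 : ℤ)⟧' = e.hom ≫ h'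
      simp
  rotate_distinguished_triangle T :=
    (rotate_distinguished_triangle (G.mapTriangle.obj T)).trans
      (distinguished_iff_of_iso (G.mapTriangleRotateIso.app T))
  complete_distinguished_triangle_morphism T₁ T₂ hT₁ hT₂ a b comm := by
    obtain ⟨c, hc₁, hc₂⟩ := complete_distinguished_triangle_morphism (G.mapTriangle.obj T₁)
      (G.mapTriangle.obj T₂) hT₁ hT₂ (G.map a) (G.map b)
      ((G.map_comp _ _).symm.trans ((G.congr_map comm).trans (G.map_comp _ _)))
    obtain ⟨c, rfl⟩ := G.map_surjective (X := T₁.obj₃) (Y := T₂.obj₃) c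
    refine ⟨c, G.map_injective ?_, G.map_injective ?_⟩
    · rw [G.map_comp, G.map_comp]
      exact hc₁
    · have := G.commShiftIso_hom_naturality a (1 : ℤ)
      rw [← cancel_mono ((G.commShiftIso (1 : ℤ)).hom.app T₂.obj₁), G.map_comp, G.map_comp,
        Category.assoc, Category.assoc, this, ← Category.assoc]
      exact hc₂

variable {S : D ⥤ D} {S' : D' ⥤ D'} {Δ : TriangleClass S} {Δ' : TriangleClass S'}

/-- Addition, shift and triangles are pulled back along `G`. The isomorphism `L ⋙ G ≅ 𝟭 D` then
makes `L` commute with shifts and preserve triangles, so one `t'` serves all such `L`. -/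
lemma TriangulatedStructure.exists_of_isEquivalence (t : TriangulatedStructure S Δ) (G : D' ⥤ D)
    [G.IsEquivalence] (φ : S' ⋙ G ≅ G ⋙ S)
    (hΔ : ∀ ⦃X Y Z : D'⦄ (f : X ⟶ Y) (g : Y ⟶ Z) (h : Z ⟶ S'.obj X),
      Δ' f g h ↔ Δ (G.map f) (G.map g) (G.map h ≫ φ.hom.app X)) :
    ∃ t' : TriangulatedStructure S' Δ', ∀ L : D ⥤ D', Nonempty (L ⋙ G ≅ 𝟭 D) →
      IsTriangleFunctor t t' L := by
  let := t.hasZeroObject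
  let := t.preadditive
  let := t.hasShift
  let := t.additive
  let := t.pretriangulated
  let := t.isTriangulated
  let hG := Functor.FullyFaithful.ofFullyFaithful G
  let s (n : ℤ) : D' ⥤ D' := G ⋙ shiftFunctor D n ⋙ G.inv
  let i (n : ℤ) : s n ⋙ G ≅ G ⋙ shiftFunctor D n :=
    Functor.associator _ _ _ ≪≫ Functor.isoWhiskerLeft G (Functor.associator _ _ _ ≪≫
      Functor.isoWhiskerLeft _ G.asEquivalence.counitIso ≪≫ Functor.rightUnitor _)
  let preadd : Preadditive D' := Preadditive.ofFullyFaithful hG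
  have : G.Additive := hG.additive_ofFullyFaithful
  let shift : HasShift D' ℤ := hG.hasShift s i
  let comm : G.CommShift ℤ := Functor.CommShift.ofHasShiftOfFullyFaithful hG s i
  have hzero : HasZeroObject D' :=
    ⟨G.objPreimage 0, (IsZero.iff_id_eq_zero _).2 (G.map_injective (by
      exact ((isZero_zero D).of_iso (G.objObjPreimageIso 0)).eq_of_src _ _))⟩
  have hadd (n : ℤ) : (shiftFunctor D' n).Additive := by
    have : (shiftFunctor D' n ⋙ G).Additive := Functor.additive_of_iso (G.commShiftIso n).symm
    exact Functor.additive_of_comp_faithful _ G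
  let pre : Pretriangulated D' := Pretriangulated.ofIsEquivalence G
  have hGt : G.IsTriangulated := ⟨fun _ hT ↦ hT⟩
  have htri : IsTriangulated D' := IsTriangulated.of_fully_faithful_triangulated_functor G
  -- `σ` is the preimage under `G` that matches `φ` with `t.shiftIso`; this makes the two
  -- descriptions of distinguished triangles agree.
  let σ : shiftFunctor D' (1 : ℤ) ≅ S' := (hG.whiskeringRight D').preimageIso
    (G.commShiftIso (1 : ℤ) ≪≫ Functor.isoWhiskerLeft G t.shiftIso ≪≫ φ.symm)
  have hσ (X : D') : G.map (σ.hom.app X) ≫ φ.hom.app X =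
      (G.commShiftIso (1 : ℤ)).hom.app X ≫ t.shiftIso.hom.app (G.obj X) := by
    have : Functor.whiskerRight σ.hom G = (G.commShiftIso (1 : ℤ) ≪≫
        Functor.isoWhiskerLeft G t.shiftIso ≪≫ φ.symm).hom :=
      (hG.whiskeringRight D').map_preimage _
    have := NatTrans.congr_app this X
    simp only [Functor.whiskerRight_app] at this
    rw [this]
    simp
  refine ⟨⟨hzero, preadd, shift, hadd, pre, htri, σ, fun T ↦ ?_⟩, ?_⟩
  · rw [hΔ, G.map_comp, Category.assoc, hσ, ← Category.assoc]
    exact t.mem_distTriang_iff (G.mapTriangle.obj T)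
  · rintro L ⟨e⟩
    let : L.CommShift ℤ := Functor.CommShift.ofComp e ℤ
    have : NatTrans.CommShift e.hom ℤ := Functor.CommShift.ofComp_compatibility e ℤ
    exact ⟨inferInstance, (Functor.isTriangulated_iff_comp_right e).2 inferInstance⟩

end Transport

/-! ### Derived equivalences -/

section Derived

variable {C₁ C₂ D₁ D₂ : Type*} [Category* C₁] [Category* C₂] [Category* D₁] [Category* D₂]

/-- As both functors invert weak equivalences, `α` and `β` are isomorphisms and composites of
derived functors are again derived, as `Adjunction.derived` requires. On objects in the image of
localization, the derived unit and counit are the original ones up to isomorphism. -/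
lemma CategoryTheory.Adjunction.exists_derived {G : C₁ ⥤ C₂} {F : C₂ ⥤ C₁} (adj : G ⊣ F)
    {L₁ : C₁ ⥤ D₁} {L₂ : C₂ ⥤ D₂} (W₁ : MorphismProperty C₁) (W₂ : MorphismProperty C₂)
    [L₁.IsLocalization W₁] [L₂.IsLocalization W₂] {G' : D₁ ⥤ D₂} {F' : D₂ ⥤ D₁}
    (α : L₁ ⋙ G' ⟶ G ⋙ L₂) (β : F ⋙ L₁ ⟶ L₂ ⋙ F') [G'.IsLeftDerivedFunctor α W₁]
    [F'.IsRightDerivedFunctor β W₂] (hG : W₁.IsInvertedBy (G ⋙ L₂))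
    (hF : W₂.IsInvertedBy (F ⋙ L₁)) (hη : ∀ X, W₁ (adj.unit.app X))
    (hε : ∀ X, W₂ (adj.counit.app X)) :
    ∃ adj' : G' ⊣ F',
      (∀ X, adj'.unit.app (L₁.obj X) ≫ F'.map (α.app X) =
        L₁.map (adj.unit.app X) ≫ β.app (G.obj X)) ∧
      (∀ X, G'.map (β.app X) ≫ adj'.counit.app (L₂.obj X) =
        α.app (F.obj X) ≫ L₂.map (adj.counit.app X)) ∧
      IsIso adj'.unit ∧ IsIso adj'.counit := by
  have hα : IsIso α := Functor.isIso_of_isLeftDerivedFunctor_of_inverts G' α hG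
  have hβ : IsIso β := Functor.isIso_of_isRightDerivedFunctor_of_inverts F' β hF
  have : (G' ⋙ F').IsLeftDerivedFunctor
      ((Functor.associator _ _ _).inv ≫ Functor.whiskerRight α F') W₁ := by
    rw [Functor.isLeftDerivedFunctor_iff_of_inverts]
    · infer_instance
    · exact fun _ _ f hf ↦ by have := hG f hf; exact Functor.map_isIso F' ((G ⋙ L₂).map f)
  have : (F' ⋙ G').IsRightDerivedFunctor
      (Functor.whiskerRight β G' ≫ (Functor.associator _ _ _).hom) W₂ := by
    rw [Functor.isRightDerivedFunctor_iff_of_inverts]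
    · infer_instance
    · exact fun _ _ f hf ↦ by have := hF f hf; exact Functor.map_isIso G' ((F ⋙ L₁).map f)
  have h₁ := adj.derivedη_fac_app W₁ α β
  have h₂ := adj.derivedε_fac_app W₂ α β
  refine ⟨adj.derived W₁ W₂ α β, h₁, h₂, ?_, ?_⟩
  · have key (X : C₁) : IsIso ((adj.derivedη W₁ α β).app (L₁.obj X)) := by
      have := Localization.inverts L₁ W₁ _ (hη X)
      have : IsIso ((adj.derivedη W₁ α β).app (L₁.obj X) ≫ F'.map (α.app X)) := by
        rw [h₁]
        infer_instance
      exact IsIso.of_isIso_comp_right _ (F'.map (α.app X))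
    have := Localization.essSurj L₁ W₁
    rw [NatTrans.isIso_iff_isIso_app]
    intro Y
    exact (NatTrans.isIso_app_iff_of_iso _ (L₁.objObjPreimageIso Y)).1 (key _)
  · have key (X : C₂) : IsIso ((adj.derivedε W₂ α β).app (L₂.obj X)) := by
      have := Localization.inverts L₂ W₂ _ (hε X)
      have : IsIso (G'.map (β.app X) ≫ (adj.derivedε W₂ α β).app (L₂.obj X)) := by
        rw [h₂]
        infer_instance
      exact IsIso.of_isIso_comp_left (G'.map (β.app X)) _
    have := Localization.essSurj L₂ W₂
    rw [NatTrans.isIso_iff_isIso_app]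
    intro Y
    exact (NatTrans.isIso_app_iff_of_iso _ (L₂.objObjPreimageIso Y)).1 (key _)

lemma CategoryTheory.Localization.exists_natIso (L : C₁ ⥤ D₁) (W : MorphismProperty C₁)
    [L.IsLocalization W] {F₁ F₂ : D₁ ⥤ D₂} (τ : L ⋙ F₁ ≅ L ⋙ F₂) :
    ∃ φ : F₁ ≅ F₂, ∀ X, φ.hom.app (L.obj X) = τ.hom.app X := by
  refine ⟨(whiskeringLeftFunctor' L W D₂).preimageIso τ, fun X ↦ ?_⟩
  have : Functor.whiskerLeft L ((whiskeringLeftFunctor' L W D₂).preimageIso τ).hom = τ.hom :=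
    (whiskeringLeftFunctor' L W D₂).map_preimage _
  exact NatTrans.congr_app this X

end Derived

lemma TriangulatedStructure.exists_iso {D : Type*} [Category* D] {S : D ⥤ D}
    {Δ : TriangleClass S} (t : TriangulatedStructure S Δ) {X Y Z X' Y' Z' : D} {f : X ⟶ Y}
    {g : Y ⟶ Z} {h : Z ⟶ S.obj X} {f' : X' ⟶ Y'} {g' : Y' ⟶ Z'} {h' : Z' ⟶ S.obj X'}
    (H : Δ f g h) (H' : Δ f' g' h') (a : X ≅ X') (b : Y ≅ Y') (w : f ≫ b.hom = a.hom ≫ f') :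
    ∃ c : Z ≅ Z', g ≫ c.hom = b.hom ≫ g' ∧ h ≫ S.map a.hom = c.hom ≫ h' := by
  let := t.hasZeroObject
  let := t.preadditive
  let := t.hasShift
  let := t.additive
  let := t.pretriangulated
  have hmem {X Y Z : D} {f : X ⟶ Y} {g : Y ⟶ Z} {h : Z ⟶ S.obj X} (H : Δ f g h) :
      Pretriangulated.Triangle.mk f g (h ≫ t.shiftIso.inv.app _) ∈
        Pretriangulated.distinguishedTriangles := by
    rw [t.mem_distTriang_iff]
    change Δ f g ((h ≫ t.shiftIso.inv.app X) ≫ t.shiftIso.hom.app X)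
    simpa using H
  let e := Pretriangulated.isoTriangleOfIso₁₂ _ _ (hmem H) (hmem H') a b w
  let c : Z ≅ Z' := Pretriangulated.Triangle.π₃.mapIso e
  have hc : (h ≫ t.shiftIso.inv.app X) ≫ a.hom⟦(1 : ℤ)⟧' =
    c.hom ≫ h' ≫ t.shiftIso.inv.app X' := e.hom.comm₃
  refine ⟨c, e.hom.comm₂, ?_⟩
  rw [← cancel_mono (t.shiftIso.inv.app X'), Category.assoc, Category.assoc, ← hc, Category.assoc,
    t.shiftIso.inv.naturality]

namespace ExactStructure

variable {C : Type u} [Category.{v} C] [Preadditive C] [HasZeroObject C] [HasBinaryBiproducts C]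
  (E : ExactStructure C) (A : C)

/-! ### The homotopy category of the coslice category -/

omit [HasZeroObject C] [HasBinaryBiproducts C] in
lemma isInvertedBy_forget_toStable :
    (E.model.under A).weq.IsInvertedBy (Under.forget A ⋙ E.toStable) :=
  fun _ _ _ hf ↦ hf

/-- The functor `Ho(A ↓ C) ⥤ E.Stable` induced by the forgetful functor. -/
def hoForget : E.HoUnder A ⥤ E.Stable :=
  Localization.lift (Under.forget A ⋙ E.toStable) (E.isInvertedBy_forget_toStable A)
    (E.toHoUnder A)

def hoForgetIso : E.toHoUnder A ⋙ E.hoForget A ≅ Under.forget A ⋙ E.toStable :=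
  Localization.fac _ _ _

instance : (E.hoForget A).IsRightDerivedFunctor (E.hoForgetIso A).inv (E.model.under A).weq :=
  Functor.isRightDerivedFunctor_of_inverts _ _ _

variable {A} (hA : E.IsProjective A)
include hA

lemma isInvertedBy_zeroShriek_toHoUnder :
    E.stableEquivalences.IsInvertedBy (zeroShriek A ⋙ E.toHoUnder A) :=
  fun _ _ f hf ↦ Localization.inverts (E.toHoUnder A) (E.model.under A).weq _
    ((stableEquivalences_zeroShriek_map hA f).2 hf)

instance : E.toStable.IsLocalization E.model.weq :=
  inferInstanceAs (E.toStable.IsLocalization E.stableEquivalences)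

lemma exists_derived_zeroShriekAdj {L : E.Stable ⥤ E.HoUnder A}
    (α : E.toStable ⋙ L ⟶ zeroShriek A ⋙ E.toHoUnder A) {R : E.HoUnder A ⥤ E.Stable}
    (β : Under.forget A ⋙ E.toStable ⟶ E.toHoUnder A ⋙ R)
    [L.IsLeftDerivedFunctor α E.model.weq]
    [R.IsRightDerivedFunctor β (E.model.under A).weq] :
    ∃ adj : L ⊣ R,
      (∀ X : C, adj.unit.app (E.toStable.obj X) ≫ R.map (α.app X) =
        E.toStable.map ((zeroShriekAdj A).unit.app X) ≫ β.app ((zeroShriek A).obj X)) ∧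
      (∀ U : Under A, L.map (β.app U) ≫ adj.counit.app ((E.toHoUnder A).obj U) =
        α.app ((Under.forget A).obj U) ≫ (E.toHoUnder A).map ((zeroShriekAdj A).counit.app U)) ∧
      IsIso adj.unit ∧ IsIso adj.counit :=
  (zeroShriekAdj A).exists_derived E.model.weq (E.model.under A).weq α β
    (E.isInvertedBy_zeroShriek_toHoUnder hA) (E.isInvertedBy_forget_toStable A)
    (fun _ ↦ stableEquivalences_zeroShriekAdj_unit hA _)
    (fun _ ↦ stableEquivalences_zeroShriekAdj_counit hA _)

/-- `hoForget` is itself a right derived functor of `0^*`, hence the right adjoint in a derived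
adjoint equivalence. -/
lemma isEquivalence_hoForget : (E.hoForget A).IsEquivalence := by
  let α := Localization.fac _ (E.isInvertedBy_zeroShriek_toHoUnder hA) E.toStable
  have := Functor.isLeftDerivedFunctor_of_inverts E.stableEquivalences _ α
  have : (Localization.lift _ (E.isInvertedBy_zeroShriek_toHoUnder hA)
    E.toStable).IsLeftDerivedFunctor α.hom E.model.weq := this
  obtain ⟨adj, -, -, _, _⟩ := E.exists_derived_zeroShriekAdj hA α.hom (E.hoForgetIso A).inv
  exact adj.toEquivalence.isEquivalence_inverse

omit hA

/-! ### Comparison of suspensions and triangles along `hoForget` -/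

variable [E.IsFrobenius]

omit [HasZeroObject C] in
variable (A) in
-- Forgetting after `zeroUnder` is the identity, so both composites agree on `(A ↓ C)` and hence on
-- its localization. The formula for `φ` controls the last morphism of a cofibre sequence.
lemma exists_hoSuspension_hoForget_iso : ∃ φ : E.hoSuspension A ⋙ E.hoForget A ≅
    E.hoForget A ⋙ E.suspension, ∀ U : Under A, φ.hom.app ((E.toHoUnder A).obj U) =
      (E.hoForget A).map ((E.hoSuspensionIso A).hom.app U) ≫
        (E.hoForgetIso A).hom.app ((zeroUnder A).obj (E.susp U.right)) ≫
          E.suspension.map ((E.hoForgetIso A).inv.app U) := by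
  let Z : E.Stable ⥤ E.HoUnder A := CategoryTheory.Quotient.lift _ (zeroUnder A ⋙ E.toHoUnder A)
    (fun _ _ _ _ h ↦ E.toHoUnder_zeroUnder_map_eq A h)
  let ψ : Z ⋙ E.hoForget A ≅ 𝟭 _ := NatIso.ofComponents
    (fun X ↦ (E.hoForgetIso A).app ((zeroUnder A).obj X.as)) (fun {X Y} f ↦ by
      obtain ⟨f, rfl⟩ := E.toStable.map_surjective (X := X.as) (Y := Y.as) f
      exact (E.hoForgetIso A).hom.naturality ((zeroUnder A).map f))
  let τ : E.toHoUnder A ⋙ E.hoSuspension A ⋙ E.hoForget A ≅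
      E.toHoUnder A ⋙ E.hoForget A ⋙ E.suspension :=
    Functor.isoWhiskerRight (E.hoSuspensionIso A) (E.hoForget A) ≪≫
      Functor.isoWhiskerLeft (Under.forget A ⋙ E.toStable ⋙ E.suspension) ψ ≪≫
        Functor.isoWhiskerRight (E.hoForgetIso A).symm E.suspension
  obtain ⟨φ, hφ⟩ := Localization.exists_natIso (E.toHoUnder A) (E.model.under A).weq τ
  exact ⟨φ, hφ⟩

omit [HasZeroObject C] in
lemma exists_isStandardHoTriangle {U V : Under A} (f : U ⟶ V) :
    ∃ (W : E.HoUnder A) (g : (E.toHoUnder A).obj V ⟶ W)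
      (h : W ⟶ (E.hoSuspension A).obj ((E.toHoUnder A).obj U)),
      E.IsStandardHoTriangle A ((E.toHoUnder A).map f) g h := by
  obtain ⟨c⟩ := nonempty_cone (E := E) f.right
  let W : Under A := Under.mk (V.hom ≫ c.g)
  let g : V ⟶ W := Under.homMk c.g rfl
  let j : E.coneUnder A U ⟶ W := Under.homMk c.j (by
    change (U.hom ≫ E.ι U.right) ≫ c.j = V.hom ≫ c.g
    rw [Category.assoc, ← c.w, ← Under.w f, Category.assoc])
  let d : W ⟶ (zeroUnder A).obj (E.susp U.right) := Under.homMk c.d (by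
    change (V.hom ≫ c.g) ≫ c.d = 0
    rw [Category.assoc, c.hg, comp_zero])
  exact ⟨_, _, _, .mk f g j d (Under.isPushout_of_isPushout_right c.sq) c.hg
    ((Under.forget A).map_injective c.hj)⟩

omit [HasZeroObject C] in
-- The defining pushout remains a pushout in `C`, and `hoSuspensionIso` cancels against its inverse
-- in the formula for `φ`.
lemma IsStandardHoTriangle.distTriangles_hoForget {X Y Z : E.HoUnder A} {f : X ⟶ Y} {g : Y ⟶ Z}
    {h : Z ⟶ (E.hoSuspension A).obj X} (H : E.IsStandardHoTriangle A f g h)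
    {φ : E.hoSuspension A ⋙ E.hoForget A ≅ E.hoForget A ⋙ E.suspension}
    (hφ : ∀ U : Under A, φ.hom.app ((E.toHoUnder A).obj U) =
      (E.hoForget A).map ((E.hoSuspensionIso A).hom.app U) ≫
        (E.hoForgetIso A).hom.app ((zeroUnder A).obj (E.susp U.right)) ≫
          E.suspension.map ((E.hoForgetIso A).inv.app U)) :
    E.distTriangles ((E.hoForget A).map f) ((E.hoForget A).map g)
      ((E.hoForget A).map h ≫ φ.hom.app X) := by
  obtain ⟨f, g, j, d, sq, hg, hj⟩ := H
  rename_i U V W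
  have : HasPushout f.right (E.ιUnder A U).right := by
    obtain ⟨c⟩ := nonempty_cone (E := E) f.right
    exact c.sq.hasPushout
  have hd := IsStandardTriangle.mk (E := E) f.right g.right j.right d.right
    (Under.isPushout_right sq) hg (congrArg (fun k ↦ k.right) hj)
  refine ⟨_, _, _, _, _, _, (E.hoForgetIso A).app U, (E.hoForgetIso A).app V,
    (E.hoForgetIso A).app W, hd, (E.hoForgetIso A).hom.naturality f,
    (E.hoForgetIso A).hom.naturality g, ?_⟩
  rw [hφ]
  have h₁ : E.suspension.map ((E.hoForgetIso A).inv.app U) ≫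
      E.suspension.map ((E.hoForgetIso A).hom.app U) = 𝟙 _ := by
    rw [← CategoryTheory.Functor.map_comp, Iso.inv_hom_id_app, CategoryTheory.Functor.map_id]
  have h₃ : (E.hoForget A).map ((E.toHoUnder A).map d) ≫ (E.hoForgetIso A).hom.app _ =
    (E.hoForgetIso A).hom.app W ≫ E.toStable.map d.right := (E.hoForgetIso A).hom.naturality d
  have aux {w z s : E.HoUnder A} {x y : E.Stable} {d : w ⟶ z} {a : z ⟶ s} {b : s ⟶ z}
      {p : (E.hoForget A).obj z ⟶ x} {r : x ⟶ y} {r' : y ⟶ x} {q : (E.hoForget A).obj w ⟶ x}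
      (hab : a ≫ b = 𝟙 z) (hr : r ≫ r' = 𝟙 x) (hq : (E.hoForget A).map d ≫ p = q) :
      ((E.hoForget A).map (d ≫ a) ≫ (E.hoForget A).map b ≫ p ≫ r) ≫ r' = q := by
    simp [← CategoryTheory.Functor.map_comp_assoc, hab, hr, hq]
  exact aux ((E.hoSuspensionIso A).inv_hom_id_app U) h₁ h₃

include hA in
-- For the converse, `f` need not come from `(A ↓ C)`, but its stable image lifts to some `k` in
-- `C`, which makes `f` isomorphic to the class of `0_! k`. Uniqueness of cones in the stable
-- category extends this to the triangles, and `hoForget` reflects the isomorphism.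
lemma hoDistTriangles_iff {φ : E.hoSuspension A ⋙ E.hoForget A ≅ E.hoForget A ⋙ E.suspension}
    (hφ : ∀ U : Under A, φ.hom.app ((E.toHoUnder A).obj U) =
      (E.hoForget A).map ((E.hoSuspensionIso A).hom.app U) ≫
        (E.hoForgetIso A).hom.app ((zeroUnder A).obj (E.susp U.right)) ≫
          E.suspension.map ((E.hoForgetIso A).inv.app U))
    {X Y Z : E.HoUnder A} (f : X ⟶ Y) (g : Y ⟶ Z) (h : Z ⟶ (E.hoSuspension A).obj X) :
    E.hoDistTriangles A f g h ↔ E.distTriangles ((E.hoForget A).map f) ((E.hoForget A).map g)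
      ((E.hoForget A).map h ≫ φ.hom.app X) := by
  have := E.isEquivalence_hoForget hA
  constructor
  · rintro ⟨X', Y', Z', f', g', h', a, b, c, H, h₁, h₂, h₃⟩
    refine isTriangulated_distTriangles.of_iso _ _ _ ⟨_, _, _, _, _, _, (E.hoForget A).mapIso a, (E.hoForget A).mapIso b,
      (E.hoForget A).mapIso c, H.distTriangles_hoForget E hφ, ?_, ?_, ?_⟩
    · simpa using (E.hoForget A).congr_map h₁
    · simpa using (E.hoForget A).congr_map h₂
    · have h₄ := φ.hom.naturality a.hom
      have h₅ := (E.hoForget A).congr_map h₃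
      simp only [(E.hoForget A).map_comp, Functor.comp_map] at h₄ h₅
      simp only [Functor.mapIso_hom, Category.assoc, ← h₄, reassoc_of% h₅]
  · intro H
    obtain ⟨k, hk⟩ := E.toStable.map_surjective (X := ((E.hoForget A).obj X).as) (Y := ((E.hoForget A).obj Y).as) ((E.hoForget A).map f)
    let e (x : C) : E.toStable.obj x ≅ (E.hoForget A).obj ((E.toHoUnder A).obj ((zeroShriek A).obj x)) :=
      have : IsIso (E.toStable.map (biprod.inr : x ⟶ A ⊞ x)) := stableEquivalences_inr hA
      asIso (E.toStable.map (biprod.inr : x ⟶ A ⊞ x)) ≪≫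
        (E.hoForgetIso A).symm.app ((zeroShriek A).obj x)
    have he {x y : C} (k : x ⟶ y) : E.toStable.map k ≫ (e y).hom =
        (e x).hom ≫ (E.hoForget A).map ((E.toHoUnder A).map ((zeroShriek A).map k)) := by
      have h₁ : E.toStable.map k ≫ E.toStable.map (biprod.inr : y ⟶ A ⊞ y) =
          E.toStable.map biprod.inr ≫ E.toStable.map ((zeroShriek A).map k).right := by
        have h := congrArg E.toStable.map (biprod.inr_map (𝟙 A) k)
        rw [E.toStable.map_comp, E.toStable.map_comp] at h
        exact h.symm
      have h₂ := (E.hoForgetIso A).inv.naturality ((zeroShriek A).map k)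
      exact (CommSq.horiz_comp ⟨h₁.symm⟩ ⟨h₂.symm⟩).w.symm
    obtain ⟨W, g', h', H'⟩ := E.exists_isStandardHoTriangle ((zeroShriek A).map k)
    let a := (E.hoForget A).preimageIso (X := X) (e ((E.hoForget A).obj X).as)
    let b := (E.hoForget A).preimageIso (X := Y) (e ((E.hoForget A).obj Y).as)
    have hab : f ≫ b.hom = a.hom ≫ (E.toHoUnder A).map ((zeroShriek A).map k) := by
      refine (E.hoForget A).map_injective ?_
      rw [(E.hoForget A).map_comp, (E.hoForget A).map_comp, ← hk]
      simpa [a, b] using he k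
    obtain ⟨t⟩ := E.nonempty_triangulatedStructure_stable
    obtain ⟨c, hc, hc'⟩ := t.exists_iso H (H'.distTriangles_hoForget E hφ) ((E.hoForget A).mapIso a)
      ((E.hoForget A).mapIso b) (by simpa using (E.hoForget A).congr_map hab)
    refine ⟨_, _, _, _, _, _, a, b, (E.hoForget A).preimageIso c, H', hab, (E.hoForget A).map_injective ?_,
      (E.hoForget A).map_injective ?_⟩
    · simpa using hc
    · have h₄ := φ.hom.naturality a.hom
      simp only [Functor.comp_map] at h₄
      rw [← cancel_mono (φ.hom.app _)]
      simpa [h₄] using hc'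

end ExactStructure

end

/-! ### The theorem -/

theorem corollary3p6 {C : Type u} [Category.{v} C] [Preadditive C] [HasZeroObject C]
    [HasBinaryBiproducts C] (E : ExactStructure C) [E.IsFrobenius]
    (hC : WeaklyIdempotentComplete C) (A : C) (hA : E.IsProjective A) (hA₀ : ¬ IsZero A) :
    -- the model structures on `C` and `(A ↓ C)`, and the Quillen equivalence `(0_!, 0^*)`
    E.model.IsClosedModel ∧ (E.model.under A).IsClosedModel ∧
    ModelClasses.IsQuillenEquivalence E.model (E.model.under A) (zeroShriekAdj A) ∧
    -- the stable category is the homotopy category of `C`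
    ∃ (_ : E.toStable.IsLocalization E.model.weq)
    -- the triangulated structures on the stable category and on `Ho(A ↓ C)`
      (t : TriangulatedStructure E.suspension E.distTriangles)
      (t' : TriangulatedStructure (E.hoSuspension A) (E.hoDistTriangles A)),
    -- the derived functors of `0_!` and `0^*` exist
      (zeroShriek A ⋙ E.toHoUnder A).HasLeftDerivedFunctor E.model.weq ∧
      (Under.forget A ⋙ E.toStable).HasRightDerivedFunctor (E.model.under A).weq ∧
      ∀ (L : E.Stable ⥤ E.HoUnder A) (α : E.toStable ⋙ L ⟶ zeroShriek A ⋙ E.toHoUnder A)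
        (R : E.HoUnder A ⥤ E.Stable) (β : Under.forget A ⋙ E.toStable ⟶ E.toHoUnder A ⋙ R)
        (_ : L.IsLeftDerivedFunctor α E.model.weq)
        (_ : R.IsRightDerivedFunctor β (E.model.under A).weq),
    -- the derived functor of `0_!` is a triangle functor
        IsTriangleFunctor t t' L ∧
    -- the derived adjunction is an adjoint equivalence
        ∃ adj : L ⊣ R,
          (∀ X : C, adj.unit.app (E.toStable.obj X) ≫ R.map (α.app X) =
            E.toStable.map ((zeroShriekAdj A).unit.app X) ≫ β.app ((zeroShriek A).obj X)) ∧
          (∀ U : Under A, L.map (β.app U) ≫ adj.counit.app ((E.toHoUnder A).obj U) =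
            α.app ((Under.forget A).obj U) ≫ (E.toHoUnder A).map ((zeroShriekAdj A).counit.app U)) ∧
          IsIso adj.unit ∧ IsIso adj.counit := by
  have hw := E.isInvertedBy_zeroShriek_toHoUnder hA
  obtain ⟨t⟩ := E.nonempty_triangulatedStructure_stable
  have := E.isEquivalence_hoForget hA
  obtain ⟨φ, hφ⟩ := E.exists_hoSuspension_hoForget_iso A
  obtain ⟨t', ht'⟩ := t.exists_of_isEquivalence (E.hoForget A) φ
    (fun _ _ _ f g h ↦ E.hoDistTriangles_iff hA hφ f g h)
  have := Functor.isLeftDerivedFunctor_of_inverts E.model.weq _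
    (Localization.fac _ hw E.toStable)
  refine ⟨E.isClosedModel_model hC, (E.isClosedModel_model hC).under A, E.isQuillenEquivalence hA,
    inferInstance, t, t', .mk' _ (Localization.fac _ hw E.toStable).hom,
    .mk' _ (E.hoForgetIso A).inv, fun L α R β _ _ ↦ ?_⟩
  obtain ⟨adj, h₁, h₂, h₃, h₄⟩ := E.exists_derived_zeroShriekAdj hA α β
  -- Pairing `L` with `hoForget` in place of `R` provides, through the unit, the isomorphism `L ⋙
  -- hoForget ≅ 𝟭` that `ht'` asks for.
  obtain ⟨adj', -, -, h₃', -⟩ := E.exists_derived_zeroShriekAdj hA α (E.hoForgetIso A).inv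
  exact ⟨ht' L ⟨(asIso adj'.unit).symm⟩, adj, h₁, h₂, h₃, h₄⟩
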